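/- Let $K=\mathbb{R}$ or $K=\mathbb{C}$, let $n\ge 1$, and let $P_n(K)$ be the space of homogeneous polynomials of degree $n$ in two variables $X,Y$ over $K$, identified with $K^{n+1}$ through the basis $X^n,X^{n-1}Y,\dots,Y^n$. Let $\mathrm{SL}_2(K)$ act on $P_n(K)$ by $$\Big(\rho_n\begin{pmatrix}a&b\\c&d\end{pmatrix}P\Big)(X,Y)=P(aX+cY,\;bX+dY),$$ and hence on the projective space $\mathbb{P}^n(K)$ of lines in $K^{n+1}$. Let $\Gamma$ be a discrete subgroup of $\mathrm{SL}_2(K)$. Then the action of $\Gamma$ on $\mathbb{P}^n(K)$ is topologically amenable, that is: there is a net $(m_i)_{i\in I}$ of continuous maps $x\mapsto m_i^x$ from $\mathbb{P}^n(K)$ to the set $\mathrm{Prob}(\Gamma)$ of probability measures on $\Gamma$ with its weak$^*$ topology, such that $$\lim_i\big\|s\,m_i^x-m_i^{sx}\big\|_1=0$$ uniformly for $(s,x)$ in compact subsets of $\Gamma\times\mathbb{P}^n(K)$, where $s\,m$ denotes the translate of $m$ under left multiplication by $s$. -/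

import Mathlib

open Filter Topology
open scoped MatrixGroups

noncomputable section

/-! ### Probability measures on a discrete group, and topologically amenable actions -/

/-- The weak-* topology on the set of probability measures on a discrete space `S`: the coarsest
topology for which `m ↦ ∑ s, f s * m s` is continuous for every real function `f` on `S` that
vanishes at infinity. (Probability measures on a discrete countable space are exactly the
probability mass functions.) -/
@[reducible] def weakStarTopology (S : Type*) : TopologicalSpace (PMF S) :=
  TopologicalSpace.induced
    (fun (m : PMF S) (f : {f : S → ℝ // Tendsto f cofinite (𝓝 0)}) =>
      ∑' s, f.1 s * (m s).toReal)
    inferInstance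

/-- The translate `g m` of a probability measure `m` on a group by a group element `g`, i.e. the
push-forward of `m` under left multiplication by `g`. -/
def translatePMF {G : Type*} [Group G] (g : G) (m : PMF G) : PMF G :=
  m.map (fun h => g * h)

/-- The `ℓ¹`-distance `‖m - m'‖₁` of two probability measures on a discrete space. -/
def l1Dist {S : Type*} (m m' : PMF S) : ℝ :=
  ∑' s, |(m s).toReal - (m' s).toReal|

/-- Topological amenability of an action, by homeomorphisms, of a discrete group `G` on a locally
compact space `X`: there is a net `(m i)` of weak-* continuous maps `X → Prob(G)` such that
`‖s (m i x) - m i (s x)‖₁ → 0` uniformly on compact subsets of `G × X`. -/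
def IsTopologicallyAmenable.{u, v} (G : Type u) (X : Type v) [Group G] [TopologicalSpace G]
    [DiscreteTopology G] [TopologicalSpace X] [LocallyCompactSpace X] [MulAction G X]
    [ContinuousConstSMul G X] : Prop :=
  ∃ (I : Type (max u v)) (_ : Preorder I) (_ : IsDirectedOrder I) (_ : Nonempty I)
    (m : I → X → PMF G),
    (∀ i, @Continuous X (PMF G) _ (weakStarTopology G) (m i)) ∧
    ∀ C : Set (G × X), IsCompact C →
      TendstoUniformlyOn
        (fun (i : I) (p : G × X) => l1Dist (translatePMF p.1 (m i p.2)) (m i (p.1 • p.2)))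
        (fun _ => 0) atTop C

/-! ### The representation of `SL₂` on binary forms -/

section Forms

variable (K : Type*) [Field K] (n : ℕ)

/-- The space of homogeneous polynomials of degree `n` in the two variables `X = X 0`, `Y = X 1`. -/
abbrev BinaryForm : Type _ := MvPolynomial.homogeneousSubmodule (Fin 2) K n

variable {K} in
/-- The linear substitution `P(X, Y) ↦ P(aX + cY, bX + dY)` for the matrix `!![a, b; c, d]`. -/
def substitution (g : Matrix (Fin 2) (Fin 2) K) :
    MvPolynomial (Fin 2) K →ₐ[K] MvPolynomial (Fin 2) K :=
  MvPolynomial.aeval fun j =>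
    MvPolynomial.C (g 0 j) * MvPolynomial.X 0 + MvPolynomial.C (g 1 j) * MvPolynomial.X 1

theorem substitution_isHomogeneous {K : Type*} [Field K] {n : ℕ} (g : Matrix (Fin 2) (Fin 2) K)
    {P : MvPolynomial (Fin 2) K} (hP : P.IsHomogeneous n) :
    (substitution g P).IsHomogeneous n := by
  have := hP.aeval (fun j => (MvPolynomial.C (g 0 j) * MvPolynomial.X 0 +
    MvPolynomial.C (g 1 j) * MvPolynomial.X 1 : MvPolynomial (Fin 2) K)) (n := 1)
    (fun j => (MvPolynomial.isHomogeneous_C_mul_X _ _).add (MvPolynomial.isHomogeneous_C_mul_X _ _))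
  rwa [one_mul] at this

theorem substitution_one {K : Type*} [Field K] :
    substitution (1 : Matrix (Fin 2) (Fin 2) K) = AlgHom.id K _ := by
  apply MvPolynomial.algHom_ext
  intro j
  fin_cases j <;> simp [substitution]

theorem substitution_mul {K : Type*} [Field K] (g h : Matrix (Fin 2) (Fin 2) K) :
    substitution (g * h) = (substitution g).comp (substitution h) := by
  apply MvPolynomial.algHom_ext
  intro j
  simp [substitution, Matrix.mul_apply, Fin.sum_univ_two]
  ring

/-- The representation `ρₙ` of `SL₂(K)` on binary forms of degree `n`. -/
def formRep : Representation K SL(2, K) (BinaryForm K n) where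
  toFun g := (substitution (g : Matrix (Fin 2) (Fin 2) K)).toLinearMap.restrict
    (fun _ hP => substitution_isHomogeneous _ hP)
  map_one' := by
    ext P : 2
    simp [substitution_one]
  map_mul' g h := by
    ext P : 2
    change substitution (g.1 * h.1) P.1 = substitution g.1 (substitution h.1 P.1)
    rw [substitution_mul, AlgHom.comp_apply]

/-- The exponent of the monomial `X ^ (n - k) * Y ^ k`. -/
def formExponent (k : Fin (n + 1)) : Fin 2 →₀ ℕ :=
  Finsupp.single 0 (n - (k : ℕ)) + Finsupp.single 1 (k : ℕ)

theorem formExponent_degree (k : Fin (n + 1)) : (formExponent n k).degree = n := by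
  rw [formExponent, map_add, Finsupp.degree_single, Finsupp.degree_single]
  omega

theorem formExponent_injective : Function.Injective (formExponent n) := by
  intro k l h
  have := DFunLike.congr_fun h 1
  simp [formExponent] at this
  exact Fin.ext this

theorem exists_formExponent {d : Fin 2 →₀ ℕ} (hd : d.degree = n) :
    ∃ k, formExponent n k = d := by
  have h : d 0 + d 1 = n := by
    rw [← hd, Finsupp.degree_eq_sum, Fin.sum_univ_two]
  refine ⟨⟨d 1, by omega⟩, ?_⟩
  ext j
  fin_cases j <;> simp [formExponent]
  omega

/-- The identification of `K ^ (n + 1)` with the binary forms of degree `n` through the basis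
`X ^ n, X ^ (n - 1) * Y, …, Y ^ n`, i.e. `c ↦ ∑ k, c k * X ^ (n - k) * Y ^ k`. -/
def formEquiv : (Fin (n + 1) → K) ≃ₗ[K] BinaryForm K n where
  toFun c := ⟨∑ k, MvPolynomial.monomial (formExponent n k) (c k),
    Submodule.sum_mem _ fun k _ =>
      MvPolynomial.isHomogeneous_monomial _ (formExponent_degree n k)⟩
  map_add' c d := by
    ext1
    simp [Finset.sum_add_distrib]
  map_smul' r c := by
    ext1
    simp [Finset.smul_sum, MvPolynomial.smul_monomial]
  invFun P k := MvPolynomial.coeff (formExponent n k) P.1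
  left_inv c := by
    ext k
    simp [MvPolynomial.coeff_sum, MvPolynomial.coeff_monomial, (formExponent_injective n).eq_iff]
  right_inv P := by
    ext d
    by_cases hd : d.degree = n
    · obtain ⟨k, rfl⟩ := exists_formExponent n hd
      simp [MvPolynomial.coeff_sum, MvPolynomial.coeff_monomial, (formExponent_injective n).eq_iff]
    · have hne : ∀ k, formExponent n k ≠ d := by
        rintro k rfl
        exact hd (formExponent_degree n k)
      rw [MvPolynomial.IsHomogeneous.coeff_eq_zero P.2 hd]
      simp [MvPolynomial.coeff_sum, MvPolynomial.coeff_monomial, hne]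

/-- The representation `ρₙ` of `SL₂(K)` on `K ^ (n + 1)`, in the coordinates of `formEquiv`. -/
def coordRep (g : SL(2, K)) : (Fin (n + 1) → K) →ₗ[K] (Fin (n + 1) → K) :=
  (formEquiv K n).symm.toLinearMap ∘ₗ formRep K n g ∘ₗ (formEquiv K n).toLinearMap

theorem coordRep_one : coordRep K n 1 = LinearMap.id := by
  ext; simp [coordRep]

theorem coordRep_mul (g h : SL(2, K)) :
    coordRep K n (g * h) = coordRep K n g ∘ₗ coordRep K n h := by
  ext; simp [coordRep]

theorem coordRep_injective (g : SL(2, K)) : Function.Injective (coordRep K n g) := by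
  apply Function.LeftInverse.injective (g := coordRep K n g⁻¹)
  intro v
  rw [← LinearMap.comp_apply, ← coordRep_mul, inv_mul_cancel, coordRep_one, LinearMap.id_apply]

/-- The projective space `ℙⁿ(K)` of lines in `K ^ (n + 1)`; a separate name, because it carries the
action of `SL₂(K)` coming from the representation `ρₙ`. -/
def ProjSpace : Type _ := Projectivization K (Fin (n + 1) → K)

/-- The linear action of `SL₂(K)` on `ℙⁿ(K)`: a matrix `g` sends the line through `v` to the line
through `ρₙ(g) v`. -/
instance : MulAction SL(2, K) (ProjSpace K n) where
  smul g := Projectivization.map (coordRep K n g) (coordRep_injective K n g)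
  one_smul x := by
    change Projectivization.map (coordRep K n 1) _ x = x
    simp only [coordRep_one]
    rw [Projectivization.map_id]
    rfl
  mul_smul g h x := by
    change Projectivization.map (coordRep K n (g * h)) _ x =
      Projectivization.map (coordRep K n g) _ (Projectivization.map (coordRep K n h) _ x)
    simp only [coordRep_mul]
    rw [Projectivization.map_comp _ (coordRep_injective K n h) _ (coordRep_injective K n g)]
    rfl

end Forms

section Topology

variable (K : Type*) [RCLike K] (n : ℕ)

/-- The quotient map from the nonzero vectors of `K ^ (n + 1)` to `ℙⁿ(K)`. -/
def ProjSpace.proj (v : {v : Fin (n + 1) → K // v ≠ 0}) : ProjSpace K n :=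
  Projectivization.mk' K v

/-- The usual (quotient) topology of `ℙⁿ(K)`. -/
instance : TopologicalSpace (ProjSpace K n) :=
  TopologicalSpace.coinduced (ProjSpace.proj K n) inferInstance

theorem ProjSpace.proj_surjective : Function.Surjective (ProjSpace.proj K n) :=
  Quotient.mk''_surjective

theorem ProjSpace.isOpenQuotientMap_proj : IsOpenQuotientMap (ProjSpace.proj K n) where
  surjective := proj_surjective K n
  continuous := continuous_coinduced_rng
  isOpenMap U hU := by
    rw [isOpen_coinduced]
    have : ProjSpace.proj K n ⁻¹' (ProjSpace.proj K n '' U) =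
        ⋃ a : Kˣ, (fun v : {v : Fin (n + 1) → K // v ≠ 0} =>
          (⟨a • v.1, (smul_ne_zero_iff_ne a).2 v.2⟩ : {v : Fin (n + 1) → K // v ≠ 0})) ⁻¹' U := by
      ext v
      simp only [Set.mem_preimage, Set.mem_image, Set.mem_iUnion]
      constructor
      · rintro ⟨w, hw, h⟩
        obtain ⟨a, ha⟩ := (Projectivization.mk_eq_mk_iff K w.1 v.1 w.2 v.2).1 h
        refine ⟨a, ?_⟩
        convert hw
      · rintro ⟨a, ha⟩
        exact ⟨_, ha, (Projectivization.mk_eq_mk_iff K _ v.1 _ v.2).2 ⟨a, rfl⟩⟩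
    rw [this]
    refine isOpen_iUnion fun a => hU.preimage ?_
    exact Continuous.subtype_mk (continuous_subtype_val.const_smul a) _

instance : LocallyCompactSpace (ProjSpace K n) := by
  have : LocallyCompactSpace {v : Fin (n + 1) → K // v ≠ 0} :=
    (isOpen_ne (x := (0 : Fin (n + 1) → K))).locallyCompactSpace
  exact (ProjSpace.isOpenQuotientMap_proj K n).locallyCompactSpace

instance : ContinuousConstSMul SL(2, K) (ProjSpace K n) where
  continuous_const_smul g := by
    rw [(ProjSpace.isOpenQuotientMap_proj K n).isQuotientMap.continuous_iff]
    have h : Continuous (coordRep K n g) := LinearMap.continuous_of_finiteDimensional _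
    exact (ProjSpace.isOpenQuotientMap_proj K n).continuous.comp
      (Continuous.subtype_mk (h.comp continuous_subtype_val)
        (fun v => (map_ne_zero_iff _ (coordRep_injective K n g)).2 v.2))

instance (Γ : Subgroup SL(2, K)) : ContinuousConstSMul Γ (ProjSpace K n) where
  continuous_const_smul g := continuous_const_smul (g : SL(2, K))

end Topology

end

/-!
Every stabilizer of a line of binary forms is amenable, because a nonzero form has only finitely
many roots on the projective line over `ℂ` and `SL₂(ℂ)` acts amenably there. The proof makes this
quantitative and explicit, with probability measures on `Γ` written down by formulas.

**Frames.** A frame `(a, b)` of `ℂ²` gives the weight `(‖γ⁻¹ a‖ + ‖γ⁻¹ b‖) ^ (-N)` on `Γ`. A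
discrete subgroup grows polynomially in the matrix norm (`exists_summable_inv_norm_pow`, a
packing argument), so the weight is summable for large `N`, and `frameLaw` is its normalization.
It is exactly equivariant (`frameLaw_mulVec_apply`), and two frames whose sizes agree up to a
factor `k` have laws at `ℓ¹`-distance at most `k ^ (2 * N) - 1` (`norm_frameLaw_sub_le`).

**Rays.** For a boundary point `[v]`, the frames `(v, e ^ (-t) v⊥)`, `t ≥ 0`, describe a
geodesic ray towards `[v]` in hyperbolic space. An element `s` carries this ray to one
asymptotic to the ray towards `[s v]`: since `s v⊥` is a combination of `(s v)⊥` and `s v` with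
bounded coefficients, the two agree up to a bounded shift of `t` and an error of order
`e ^ (-t)` (`norm_frameLaw_mulVec_sub_rayLaw_le`). Averages over long pieces of rays are therefore
asymptotically equivariant, uniformly in `[v]` (`tendsto_norm_translatedRayAverage_sub`). They
depend only on `[v]`, and continuously.

**Roots.** A binary form over `ℂ` of degree `n` is a product of `n` linear forms, unique up to
order and scalars, and `SL₂` permutes linear forms compatibly. Averaging the measures above over
the `n` roots gives the required measures on projective space. Continuity holds because the
compact space of `n`-tuples of roots (with a phase) maps onto the unit sphere of forms, so that
this map is a quotient map (`isQuotientMap_sphereParam`, `continuousOn_rootAverage`). Real forms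
are regarded as complex forms through `complexEmbedding`.
-/

open scoped Matrix ENNReal

/-! ### Polynomial growth of discrete subgroups -/

open MeasureTheory in
/-- The growth bound for discrete subgroups, in the form of a packing estimate: a family of points
in a finite-dimensional space whose mutual distances are bounded below by a multiple of the inverse
of the norm grows at most polynomially. The balls of radius `r / (2 ‖e i‖)` about the points are
disjoint, so a sum over the family is dominated by the integral of a power of `1 + ‖x‖`. -/
theorem summable_inv_norm_pow_of_separated {ι E : Type*} [NormedAddCommGroup E] [NormedSpace ℝ E]
    [FiniteDimensional ℝ E] (e : ι → E) {r : ℝ} (hr : 0 < r) (hlow : ∀ i, 1 / 2 ≤ ‖e i‖)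
    (hsep : ∀ i j, i ≠ j → r / ‖e i‖ ≤ dist (e i) (e j)) :
    Summable fun i => (‖e i‖ ^ (2 * Module.finrank ℝ E + 1))⁻¹ := by
  let _ : MeasurableSpace E := borel E
  have _ : BorelSpace E := ⟨rfl⟩
  let μ : Measure E := Measure.addHaar
  set d := Module.finrank ℝ E with hd
  let f : E → ℝ := fun x => (1 + ‖x‖) ^ (-((d : ℝ) + 1))
  have hf : Integrable f μ := integrable_one_add_norm (by rw [← hd]; linarith)
  have hf0 : ∀ x, 0 ≤ f x := fun x => by positivity
  have hpos : ∀ i, 0 < ‖e i‖ := fun i => by linarith [hlow i]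
  let ρ : ι → ℝ := fun i => r / (2 * ‖e i‖)
  have hρ : ∀ i, 0 < ρ i := fun i => by have := hpos i; positivity
  have hρr : ∀ i, ρ i ≤ r := fun i => by
    have := hlow i
    exact div_le_self hr.le (by linarith)
  have hρ2 : ∀ i, r / ‖e i‖ = 2 * ρ i := fun i => by
    have := (hpos i).ne'
    simp only [ρ]; field_simp
  have hdisj : ∀ i j, i ≠ j → Disjoint (Metric.ball (e i) (ρ i)) (Metric.ball (e j) (ρ j)) := by
    intro i j hij
    apply Metric.ball_disjoint_ball
    have h1 := hsep i j hij
    have h2 := hsep j i hij.symm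
    rw [dist_comm, hρ2] at h2
    rw [hρ2] at h1
    linarith
  -- On the ball about `e i`, the quantity `1 + ‖x‖` is at most `C * ‖e i‖`.
  set C : ℝ := 2 * (1 + r) + 1 with hC
  have hC0 : 0 < C := by positivity
  set V : ℝ := μ.real (Metric.ball 0 1) with hV
  have hV0 : 0 < V := ENNReal.toReal_pos (Metric.measure_ball_pos μ 0 one_pos).ne'
    measure_ball_lt_top.ne
  have hvol : ∀ i, μ.real (Metric.ball (e i) (ρ i)) = ρ i ^ d * V := fun i => by
    rw [Measure.real, Measure.addHaar_ball_of_pos μ (e i) (hρ i), ENNReal.toReal_mul,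
      ENNReal.toReal_ofReal (by have := hρ i; positivity)]
    rfl
  have hlb : ∀ i, ∀ x ∈ Metric.ball (e i) (ρ i), ((C * ‖e i‖) ^ (d + 1))⁻¹ ≤ f x := by
    intro i x hx
    have h1 : ‖x‖ ≤ ‖e i‖ + r := by
      have := norm_le_norm_add_norm_sub (e i) x
      rw [mem_ball_iff_norm] at hx
      rw [norm_sub_rev] at this
      have := hρr i
      have h3 := norm_sub_rev (e i) x
      linarith
    have h2 : 1 + ‖x‖ ≤ C * ‖e i‖ := by
      have := hlow i
      rw [hC]
      nlinarith
    have h3 : f x = ((1 + ‖x‖) ^ (d + 1))⁻¹ := by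
      simp only [f]
      rw [Real.rpow_neg (by positivity), ← Real.rpow_natCast]
      push_cast
      rfl
    rw [h3]
    gcongr
  have hint : ∀ i, (r / 2) ^ d * V * (C ^ (d + 1))⁻¹ * (‖e i‖ ^ (2 * d + 1))⁻¹ ≤
      ∫ x in Metric.ball (e i) (ρ i), f x ∂μ := by
    intro i
    have h1 := setIntegral_ge_of_const_le_real (μ := μ) (s := Metric.ball (e i) (ρ i))
      measurableSet_ball measure_ball_lt_top.ne (hlb i) hf.integrableOn
    refine le_trans (le_of_eq ?_) h1
    rw [hvol]
    have := (hpos i).ne'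
    rw [mul_pow, show 2 * d + 1 = d + (d + 1) by ring, pow_add ‖e i‖]
    field_simp
    rw [← mul_pow]
    congr 1
    simp only [ρ]
    field_simp
  have hsum : Summable fun i =>
      (r / 2) ^ d * V * (C ^ (d + 1))⁻¹ * (‖e i‖ ^ (2 * d + 1))⁻¹ := by
    refine summable_of_sum_le (c := ∫ x, f x ∂μ) (fun i => ?_) fun t => ?_
    · have := hpos i
      positivity
    · calc _ ≤ ∑ i ∈ t, ∫ x in Metric.ball (e i) (ρ i), f x ∂μ :=
            Finset.sum_le_sum fun i _ => hint i
        _ = ∫ x in ⋃ i ∈ t, Metric.ball (e i) (ρ i), f x ∂μ := by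
            rw [integral_biUnion_finset t (fun i _ => measurableSet_ball)
              (fun i _ j _ hij => hdisj i j hij) (fun i _ => hf.integrableOn)]
        _ ≤ ∫ x, f x ∂μ := setIntegral_le_integral hf (ae_of_all _ hf0)
  exact (summable_mul_left_iff (by positivity)).1 hsum

/-- The embedding `x ↦ re x + im x * i` of `K = ℝ` or `K = ℂ` into `ℂ`. -/
noncomputable def complexEmbedding (K : Type*) [RCLike K] : K →+* ℂ where
  toFun x := ⟨RCLike.re x, RCLike.im x⟩
  map_one' := by apply Complex.ext <;> simp
  map_mul' x y := by apply Complex.ext <;> simp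
  map_zero' := by apply Complex.ext <;> simp
  map_add' x y := by apply Complex.ext <;> simp

theorem norm_complexEmbedding {K : Type*} [RCLike K] (x : K) : ‖complexEmbedding K x‖ = ‖x‖ := by
  have h : ‖complexEmbedding K x‖ ^ 2 = ‖x‖ ^ 2 := by
    rw [← Complex.normSq_eq_norm_sq, RCLike.norm_sq_eq_def]
    rfl
  exact (pow_left_inj₀ (norm_nonneg _) (norm_nonneg _) two_ne_zero).1 h

theorem continuous_complexEmbedding (K : Type*) [RCLike K] : Continuous (complexEmbedding K) :=
  (AddMonoidHomClass.isometry_of_norm (complexEmbedding K) norm_complexEmbedding).continuous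

/-- The entries of a `2 × 2` matrix as a vector, so that its norm is the largest absolute value of
an entry. -/
def entries {K : Type*} (A : Matrix (Fin 2) (Fin 2) K) : Fin 2 → Fin 2 → K := A

theorem norm_entry_le {K : Type*} [NormedField K] (A : Matrix (Fin 2) (Fin 2) K) (i j : Fin 2) :
    ‖A i j‖ ≤ ‖entries A‖ :=
  (norm_le_pi_norm (entries A i) j).trans (norm_le_pi_norm (entries A) i)

theorem norm_entries_le {K : Type*} [NormedField K] {A : Matrix (Fin 2) (Fin 2) K} {c : ℝ}
    (hc : 0 ≤ c) (h : ∀ i j, ‖A i j‖ ≤ c) : ‖entries A‖ ≤ c :=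
  (pi_norm_le_iff_of_nonneg hc).2 fun i => (pi_norm_le_iff_of_nonneg hc).2 fun j => h i j

theorem norm_entries_mul_le {K : Type*} [NormedField K] (A B : Matrix (Fin 2) (Fin 2) K) :
    ‖entries (A * B)‖ ≤ 2 * (‖entries A‖ * ‖entries B‖) := by
  refine norm_entries_le (by positivity) fun i j => ?_
  rw [Matrix.mul_apply, Fin.sum_univ_two]
  have h : ∀ k, ‖A i k * B k j‖ ≤ ‖entries A‖ * ‖entries B‖ := fun k => by
    rw [norm_mul]
    exact mul_le_mul (norm_entry_le A i k) (norm_entry_le B k j) (norm_nonneg _) (norm_nonneg _)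
  linarith [norm_add_le (A i 0 * B 0 j) (A i 1 * B 1 j), h 0, h 1]

theorem norm_entries_inv {K : Type*} [NormedField K] (g : SL(2, K)) :
    ‖entries (g⁻¹ : SL(2, K)).1‖ ≤ ‖entries g.1‖ := by
  refine norm_entries_le (norm_nonneg _) fun i j => ?_
  rw [Matrix.SpecialLinearGroup.coe_inv, Matrix.adjugate_fin_two]
  fin_cases i <;> fin_cases j <;> simp [norm_entry_le]

theorem half_le_norm_entries {K : Type*} [NormedField K] (g : SL(2, K)) :
    1 / 2 ≤ ‖entries g.1‖ := by
  by_contra! h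
  have hdet := g.2
  rw [Matrix.det_fin_two] at hdet
  have h1 : ∀ i j k l, ‖g.1 i j * g.1 k l‖ ≤ 1 / 2 * (1 / 2) := fun i j k l => by
    rw [norm_mul]
    exact mul_le_mul ((norm_entry_le _ i j).trans h.le) ((norm_entry_le _ k l).trans h.le)
      (norm_nonneg _) (by norm_num)
  have h2 := norm_sub_le (g.1 0 0 * g.1 1 1) (g.1 0 1 * g.1 1 0)
  rw [hdet, norm_one] at h2
  linarith [h1 0 0 1 1, h1 0 1 1 0]

theorem norm_entries_map {K : Type*} [RCLike K] (A : Matrix (Fin 2) (Fin 2) K) :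
    ‖entries (A.map (complexEmbedding K))‖ = ‖entries A‖ := by
  refine le_antisymm (norm_entries_le (norm_nonneg _) fun i j => ?_)
    (norm_entries_le (norm_nonneg _) fun i j => ?_)
  · rw [Matrix.map_apply, norm_complexEmbedding]
    exact norm_entry_le A i j
  · exact (norm_complexEmbedding (A i j)).symm.le.trans
      (norm_entry_le (A.map (complexEmbedding K)) i j)

/-- A discrete subgroup of `SL₂(K)` grows at most polynomially with respect to the matrix norm. -/
theorem exists_summable_inv_norm_pow {K : Type*} [RCLike K] (Γ : Subgroup SL(2, K))
    [DiscreteTopology Γ] :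
    ∃ N : ℕ, Summable fun γ : Γ => (‖entries γ.1.1‖ ^ N)⁻¹ := by
  obtain ⟨r, hr, hr1⟩ : ∃ r > 0, ∀ γ : Γ, ‖entries (γ.1.1 - 1)‖ < r → γ = 1 := by
    have hind : IsInducing fun γ : Γ => entries γ.1.1 :=
      (Topology.IsInducing.subtypeVal (t := {A : Matrix (Fin 2) (Fin 2) K | A.det = 1})).comp
        (Topology.IsInducing.subtypeVal (t := {g : SL(2, K) | g ∈ Γ}))
    have h1 : ({1} : Set Γ) ∈ 𝓝 (1 : Γ) := by
      rw [nhds_discrete]; exact Set.mem_singleton _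
    rw [hind.nhds_eq_comap, (Metric.nhds_basis_ball.comap _).mem_iff] at h1
    obtain ⟨r, hr, h⟩ := h1
    refine ⟨r, hr, fun γ hγ => h ?_⟩
    rw [Set.mem_preimage, mem_ball_iff_norm]
    exact hγ
  let e : Γ → Fin 2 → Fin 2 → ℂ := fun γ => entries (γ.1.1.map (complexEmbedding K))
  refine ⟨2 * Module.finrank ℝ (Fin 2 → Fin 2 → ℂ) + 1,
    (summable_inv_norm_pow_of_separated e (r := r / 2) (by positivity) ?_ ?_).congr
    fun γ => by simp only [e, norm_entries_map]⟩
  · intro γ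
    simp only [e, norm_entries_map]
    exact half_le_norm_entries _
  · intro γ δ hγδ
    have hne : r ≤ ‖entries ((γ⁻¹ * δ : Γ).1.1 - 1)‖ := by
      by_contra! h
      exact hγδ (inv_mul_eq_one.1 (hr1 _ h))
    -- Distinct elements satisfy `r ≤ ‖γ⁻¹ * δ - 1‖ = ‖γ⁻¹ * (δ - γ)‖ ≤ 2 * ‖γ‖ * ‖δ - γ‖`.
    have h1 : (γ⁻¹ * δ : Γ).1.1 - 1 = (γ.1⁻¹ : SL(2, K)).1 * (δ.1.1 - γ.1.1) := by
      have : (γ.1⁻¹ : SL(2, K)).1 * γ.1.1 = 1 := by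
        rw [← Matrix.SpecialLinearGroup.coe_mul, inv_mul_cancel]; rfl
      rw [mul_sub, this]
      rfl
    have h2 : dist (e γ) (e δ) = ‖entries (δ.1.1 - γ.1.1)‖ := by
      rw [dist_comm, dist_eq_norm, ← norm_entries_map]
      congr 1
      ext i j
      simp [e, entries]
      rfl
    rw [h1] at hne
    have h3 := hne.trans (norm_entries_mul_le _ _)
    have h4 := half_le_norm_entries γ.1
    rw [h2]
    simp only [e, norm_entries_map]
    rw [div_le_iff₀ (by linarith)]
    have h5 := mul_le_mul_of_nonneg_right (norm_entries_inv γ.1)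
      (norm_nonneg (entries (δ.1.1 - γ.1.1)))
    linarith

/-! ### Probability vectors in `ℓ¹` -/

/-- The Banach space `ℓ¹(S)` of absolutely summable real functions on `S`. -/
abbrev EllOne (S : Type*) : Type _ := lp (fun _ : S => ℝ) 1

theorem ellOne_norm_eq_tsum {S : Type*} (f : EllOne S) : ‖f‖ = ∑' s, |f s| := by
  rw [lp.norm_eq_tsum_rpow (by simp)]
  simp

theorem ellOne_summable {S : Type*} (f : EllOne S) : Summable fun s => f s := by
  have h := (lp.memℓp f).summable (by simp)
  simp only [ENNReal.toReal_one, Real.rpow_one] at h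
  exact h.of_norm

theorem memlp_one_of_summable {S : Type*} {f : S → ℝ} (hf : Summable f) : Memℓp f 1 := by
  rw [memℓp_gen_iff (by simp)]
  simpa using hf.norm

/-- The elements of `ℓ¹(S)` that are probability measures. -/
structure IsProbVector {S : Type*} (f : EllOne S) : Prop where
  nonneg : ∀ s, 0 ≤ f s
  tsum_eq_one : ∑' s, f s = 1

theorem IsProbVector.norm_eq_one {S : Type*} {f : EllOne S} (hf : IsProbVector f) : ‖f‖ = 1 := by
  rw [ellOne_norm_eq_tsum, ← hf.tsum_eq_one]
  exact tsum_congr fun s => abs_of_nonneg (hf.nonneg s)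

theorem ellOne_average_apply {S ι : Type*} (t : Finset ι) (f : ι → EllOne S) (s : S) :
    ((t.card : ℝ)⁻¹ • ∑ i ∈ t, f i : EllOne S) s = (t.card : ℝ)⁻¹ * ∑ i ∈ t, f i s := by
  rw [lp.coeFn_smul, Pi.smul_apply, lp.coeFn_sum, Finset.sum_apply, smul_eq_mul]

theorem isProbVector_average {S ι : Type*} {t : Finset ι} (ht : t.Nonempty) {f : ι → EllOne S}
    (hf : ∀ i ∈ t, IsProbVector (f i)) : IsProbVector ((t.card : ℝ)⁻¹ • ∑ i ∈ t, f i) := by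
  constructor
  · intro s
    rw [ellOne_average_apply]
    exact mul_nonneg (by positivity) (Finset.sum_nonneg fun i hi => (hf i hi).nonneg s)
  · rw [tsum_congr (ellOne_average_apply t f), tsum_mul_left,
      Summable.tsum_finsetSum fun i _ => ellOne_summable (f i),
      Finset.sum_congr rfl fun i hi => (hf i hi).tsum_eq_one]
    have : (t.card : ℝ) ≠ 0 := by simpa using ht.ne_empty
    simp [this]

open Classical in
/-- A summable function as an element of `ℓ¹(S)`; by convention `0` if it is not summable. -/
noncomputable def toEllOne {S : Type*} (f : S → ℝ) : EllOne S :=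
  if h : Summable f then ⟨f, memlp_one_of_summable h⟩ else 0

/-- The probability vector proportional to a positive summable weight. -/
noncomputable def normalized {S : Type*} (w : S → ℝ) : EllOne S :=
  toEllOne fun s => w s / ∑' s, w s

theorem normalized_apply {S : Type*} {w : S → ℝ} (hw : Summable w) (s : S) :
    normalized w s = w s / ∑' s, w s := by
  rw [normalized, toEllOne, dif_pos (hw.div_const _)]

theorem isProbVector_normalized {S : Type*} [Nonempty S] {w : S → ℝ} (hw : Summable w)
    (hpos : ∀ s, 0 < w s) : IsProbVector (normalized w) := by
  have h0 : 0 < ∑' s, w s :=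
    hw.tsum_pos (fun s => (hpos s).le) (Classical.arbitrary S) (hpos _)
  constructor
  · intro s
    rw [normalized_apply hw]
    exact div_nonneg (hpos s).le h0.le
  · rw [tsum_congr (normalized_apply hw), tsum_div_const, div_self h0.ne']

/-- Weights that agree up to the factor `k` have `ℓ¹`-close normalizations. -/
theorem norm_normalized_sub_le {S : Type*} [Nonempty S] {w w' : S → ℝ} (hw : Summable w)
    (hw' : Summable w') (hpos : ∀ s, 0 < w s) (hpos' : ∀ s, 0 < w' s) {k : ℝ} (hk : 1 ≤ k)
    (h : ∀ s, w s ≤ k * w' s) (h' : ∀ s, w' s ≤ k * w s) :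
    ‖normalized w - normalized w'‖ ≤ k ^ 2 - 1 := by
  have h0 : 0 < ∑' s, w s :=
    hw.tsum_pos (fun s => (hpos s).le) (Classical.arbitrary S) (hpos _)
  have h0' : 0 < ∑' s, w' s :=
    hw'.tsum_pos (fun s => (hpos' s).le) (Classical.arbitrary S) (hpos' _)
  have ht : ∑' s, w s ≤ k * ∑' s, w' s := by
    rw [← tsum_mul_left]; exact hw.tsum_le_tsum h (hw'.mul_left k)
  have ht' : ∑' s, w' s ≤ k * ∑' s, w s := by
    rw [← tsum_mul_left]; exact hw'.tsum_le_tsum h' (hw.mul_left k)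
  set W := ∑' s, w s
  set W' := ∑' s, w' s
  have hb : ∀ s, |normalized w s - normalized w' s| ≤ (k ^ 2 - 1) * normalized w s := by
    intro s
    rw [normalized_apply hw, normalized_apply hw']
    have h1 : w s / W ≤ k ^ 2 * (w' s / W') := by
      rw [← mul_div_assoc, div_le_div_iff₀ h0 h0']
      calc w s * W' ≤ (k * w' s) * (k * W) := by
            gcongr
            · exact mul_nonneg (by linarith) (hpos' s).le
            · exact h s
        _ = k ^ 2 * w' s * W := by ring
    have h2 : w' s / W' ≤ k ^ 2 * (w s / W) := by
      rw [← mul_div_assoc, div_le_div_iff₀ h0' h0]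
      calc w' s * W ≤ (k * w s) * (k * W') := by
            gcongr
            · exact mul_nonneg (by linarith) (hpos s).le
            · exact h' s
        _ = k ^ 2 * w s * W' := by ring
    have h3 : 0 < w s / W := div_pos (hpos s) h0
    have h4 : 0 < w' s / W' := div_pos (hpos' s) h0'
    have hk2 : 1 ≤ k ^ 2 := one_le_pow₀ hk
    rw [abs_le]
    constructor
    · linarith
    · by_cases hc : w s / W ≤ w' s / W'
      · nlinarith
      · push Not at hc
        nlinarith
  have hP := isProbVector_normalized hw hpos
  rw [ellOne_norm_eq_tsum]
  calc ∑' s, |(normalized w - normalized w') s| ≤ ∑' s, (k ^ 2 - 1) * normalized w s := by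
        refine Summable.tsum_le_tsum (fun s => ?_) ?_ ((ellOne_summable _).mul_left _)
        · rw [lp.coeFn_sub, Pi.sub_apply]
          exact hb s
        · exact (ellOne_summable (normalized w - normalized w')).abs
    _ = k ^ 2 - 1 := by rw [tsum_mul_left, hP.tsum_eq_one, mul_one]

theorem normalized_congr_mul {S : Type*} {w w' : S → ℝ} {c : ℝ} (hc : c ≠ 0)
    (h : ∀ s, w' s = c * w s) : normalized w' = normalized w := by
  have : (fun s => w' s / ∑' s, w' s) = fun s => w s / ∑' s, w s := by
    funext s
    rw [tsum_congr h, tsum_mul_left, h, mul_div_mul_left _ _ hc]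
  rw [normalized, this, normalized]

/-! ### Equivariant maps from frames of `ℂ²` to probability vectors -/

section Frames

variable {G : Type*} [Group G] (ρ : G →* SL(2, ℂ))

/-- The size of the matrix `ρ γ⁻¹`, measured on the frame `(a, b)` of `ℂ²`. -/
noncomputable def frameSize (a b : Fin 2 → ℂ) (γ : G) : ℝ :=
  ‖(ρ γ⁻¹).1 *ᵥ a‖ + ‖(ρ γ⁻¹).1 *ᵥ b‖

/-- The determinant of a pair of vectors of `ℂ²`. -/
noncomputable def frameDet (a b : Fin 2 → ℂ) : ℂ := a 0 * b 1 - a 1 * b 0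

variable {ρ}

theorem frameSize_nonneg (a b : Fin 2 → ℂ) (γ : G) : 0 ≤ frameSize ρ a b γ := by
  unfold frameSize; positivity

theorem frameSize_combination_le {a b : Fin 2 → ℂ} {α β α' β' : ℂ} {K : ℝ}
    (h : ‖α‖ + ‖α'‖ ≤ K) (h' : ‖β‖ + ‖β'‖ ≤ K) (γ : G) :
    frameSize ρ (α • a + β • b) (α' • a + β' • b) γ ≤ K * frameSize ρ a b γ := by
  unfold frameSize
  simp only [Matrix.mulVec_add, Matrix.mulVec_smul]
  set x := (ρ γ⁻¹).1 *ᵥ a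
  set y := (ρ γ⁻¹).1 *ᵥ b
  have h1 := norm_add_le (α • x) (β • y)
  have h2 := norm_add_le (α' • x) (β' • y)
  simp only [norm_smul] at h1 h2
  nlinarith [norm_nonneg x, norm_nonneg y]

/-- Cramer's rule in `ℂ²`. -/
theorem frame_expansion {a b : Fin 2 → ℂ} (hab : frameDet a b ≠ 0) (v : Fin 2 → ℂ) :
    v = (frameDet v b / frameDet a b) • a + (frameDet a v / frameDet a b) • b := by
  have h : ∀ i, v i * frameDet a b = frameDet v b * a i + frameDet a v * b i := by
    intro i
    fin_cases i <;> simp [frameDet] <;> ring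
  ext i
  simp only [Pi.add_apply, Pi.smul_apply, smul_eq_mul]
  field_simp
  rw [h i]

theorem frameSize_le_mul {a b : Fin 2 → ℂ} (hab : frameDet a b ≠ 0) (a' b' : Fin 2 → ℂ) (γ : G) :
    frameSize ρ a' b' γ ≤
      max (‖frameDet a' b / frameDet a b‖ + ‖frameDet b' b / frameDet a b‖)
        (‖frameDet a a' / frameDet a b‖ + ‖frameDet a b' / frameDet a b‖) *
      frameSize ρ a b γ := by
  conv_lhs => rw [frame_expansion hab a', frame_expansion hab b']
  exact frameSize_combination_le (le_max_left _ _) (le_max_right _ _) γ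

theorem norm_entries_le_mul_frameSize {a b : Fin 2 → ℂ} (hab : frameDet a b ≠ 0) :
    ∃ K > 0, ∀ γ : G, ‖entries (ρ γ⁻¹).1‖ ≤ K * frameSize ρ a b γ := by
  refine ⟨max _ _ + 1, ?_, fun γ => le_trans ?_ ((frameSize_le_mul hab
    (Pi.single 0 1) (Pi.single 1 1) γ).trans
    (mul_le_mul_of_nonneg_right (le_add_of_nonneg_right zero_le_one) (frameSize_nonneg _ _ _)))⟩
  · positivity
  · refine norm_entries_le (frameSize_nonneg _ _ _) fun i j => ?_
    unfold frameSize
    have h : ∀ j, ‖(ρ γ⁻¹).1 i j‖ ≤ ‖(ρ γ⁻¹).1 *ᵥ Pi.single j 1‖ := fun j => by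
      have := norm_le_pi_norm ((ρ γ⁻¹).1 *ᵥ Pi.single j 1) i
      simpa using this
    have h0 := norm_nonneg ((ρ γ⁻¹).1 *ᵥ Pi.single 0 1)
    have h1 := norm_nonneg ((ρ γ⁻¹).1 *ᵥ Pi.single 1 1)
    fin_cases j
    · exact (h 0).trans (by linarith)
    · exact (h 1).trans (by linarith)

theorem frameSize_pos {a b : Fin 2 → ℂ} (hab : frameDet a b ≠ 0) (γ : G) :
    0 < frameSize ρ a b γ := by
  obtain ⟨K, hK, h⟩ := norm_entries_le_mul_frameSize (ρ := ρ) hab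
  exact pos_of_mul_pos_right (lt_of_lt_of_le (by linarith [half_le_norm_entries (ρ γ⁻¹)]) (h γ))
    hK.le

theorem frameSize_mulVec (s : G) (a b : Fin 2 → ℂ) (γ : G) :
    frameSize ρ ((ρ s).1 *ᵥ a) ((ρ s).1 *ᵥ b) γ = frameSize ρ a b (s⁻¹ * γ) := by
  have : (ρ γ⁻¹).1 * (ρ s).1 = (ρ (s⁻¹ * γ)⁻¹).1 := by
    rw [← Matrix.SpecialLinearGroup.coe_mul, ← map_mul, mul_inv_rev, inv_inv]
  simp only [frameSize, Matrix.mulVec_mulVec, this]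

variable (ρ) in
/-- The probability vector on `G` whose mass at `γ` is proportional to the power `-N` of the size of
`ρ γ⁻¹` in the frame `(a, b)`. It depends equivariantly on the frame, and changes little when
the sizes measured on the frame change by factors close to one. -/
noncomputable def frameLaw (N : ℕ) (a b : Fin 2 → ℂ) : EllOne G :=
  normalized fun γ => (frameSize ρ a b γ ^ N)⁻¹

theorem frameLaw_smul {N : ℕ} {c d : ℂ} (hc : c ≠ 0) (hcd : ‖d‖ = ‖c‖) (a b : Fin 2 → ℂ) :
    frameLaw ρ N (c • a) (d • b) = frameLaw ρ N a b := by
  refine normalized_congr_mul (c := (‖c‖ ^ N)⁻¹) (by positivity) fun γ => ?_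
  have : frameSize ρ (c • a) (d • b) γ = ‖c‖ * frameSize ρ a b γ := by
    simp only [frameSize, Matrix.mulVec_smul, norm_smul, hcd]
    ring
  rw [this, mul_pow, mul_inv]

variable {N : ℕ} (hN : Summable fun γ : G => (‖entries (ρ γ).1‖ ^ N)⁻¹)
include hN

theorem summable_frameSize {a b : Fin 2 → ℂ} (hab : frameDet a b ≠ 0) :
    Summable fun γ : G => (frameSize ρ a b γ ^ N)⁻¹ := by
  obtain ⟨K, hK, h⟩ := norm_entries_le_mul_frameSize (ρ := ρ) hab
  refine Summable.of_nonneg_of_le (fun γ => ?_) (fun γ => ?_)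
    (((Equiv.inv G).summable_iff.2 hN).mul_left (K ^ N))
  · have := frameSize_pos (ρ := ρ) hab γ
    positivity
  · have h1 := frameSize_pos (ρ := ρ) hab γ
    have h2 := half_le_norm_entries (ρ γ⁻¹)
    have h3 : 0 < ‖entries (ρ γ⁻¹).1‖ := by linarith
    simp only [Function.comp_apply, Equiv.inv_apply]
    rw [inv_eq_one_div, ← div_eq_mul_inv, div_le_div_iff₀ (by positivity) (by positivity), one_mul,
      ← mul_pow]
    exact pow_le_pow_left₀ h3.le (h γ) N

theorem isProbVector_frameLaw {a b : Fin 2 → ℂ} (hab : frameDet a b ≠ 0) :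
    IsProbVector (frameLaw ρ N a b) :=
  isProbVector_normalized (summable_frameSize hN hab) fun γ => by
    have := frameSize_pos (ρ := ρ) hab γ
    positivity

theorem norm_frameLaw_sub_le {a b a' b' : Fin 2 → ℂ} (hab : frameDet a b ≠ 0)
    (hab' : frameDet a' b' ≠ 0) {k : ℝ} (hk : 1 ≤ k)
    (h : ∀ γ, frameSize ρ a b γ ≤ k * frameSize ρ a' b' γ)
    (h' : ∀ γ, frameSize ρ a' b' γ ≤ k * frameSize ρ a b γ) :
    ‖frameLaw ρ N a b - frameLaw ρ N a' b'‖ ≤ k ^ (2 * N) - 1 := by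
  have hp := frameSize_pos (ρ := ρ) hab
  have hp' := frameSize_pos (ρ := ρ) hab'
  have key : ∀ x y : ℝ, 0 < x → 0 < y → y ≤ k * x → (x ^ N)⁻¹ ≤ k ^ N * (y ^ N)⁻¹ := by
    intro x y hx hy hxy
    rw [inv_eq_one_div, ← div_eq_mul_inv, div_le_div_iff₀ (by positivity) (by positivity), one_mul,
      ← mul_pow]
    exact pow_le_pow_left₀ hy.le hxy N
  rw [mul_comm 2 N, pow_mul]
  refine norm_normalized_sub_le (summable_frameSize hN hab) (summable_frameSize hN hab')
    (fun γ => ?_) (fun γ => ?_) (one_le_pow₀ hk) (fun γ => ?_) (fun γ => ?_)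
  · have := hp γ; positivity
  · have := hp' γ; positivity
  · exact key _ _ (hp γ) (hp' γ) (h' γ)
  · exact key _ _ (hp' γ) (hp γ) (h γ)

theorem frameLaw_mulVec_apply (s : G) {a b : Fin 2 → ℂ} (hab : frameDet a b ≠ 0) (γ : G) :
    frameLaw ρ N ((ρ s).1 *ᵥ a) ((ρ s).1 *ᵥ b) γ = frameLaw ρ N a b (s⁻¹ * γ) := by
  have hw := summable_frameSize hN hab
  have hw' : Summable fun γ : G => (frameSize ρ ((ρ s).1 *ᵥ a) ((ρ s).1 *ᵥ b) γ ^ N)⁻¹ := by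
    simp only [frameSize_mulVec]
    exact (Equiv.mulLeft s⁻¹).summable_iff.2 hw
  rw [frameLaw, frameLaw, normalized_apply hw, normalized_apply hw']
  simp only [frameSize_mulVec]
  congr 1
  exact (Equiv.mulLeft s⁻¹).tsum_eq fun γ => (frameSize ρ a b γ ^ N)⁻¹

end Frames

/-! ### Averages along geodesic rays -/

/-- The vector `(-conj v₁, conj v₀)`, orthogonal to `v` and of the same length. -/
noncomputable def perp (v : Fin 2 → ℂ) : Fin 2 → ℂ :=
  ![-(starRingEnd ℂ) (v 1), (starRingEnd ℂ) (v 0)]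

/-- The square of the Euclidean length of a vector of `ℂ²`. -/
noncomputable def lengthSq (v : Fin 2 → ℂ) : ℝ := ‖v 0‖ ^ 2 + ‖v 1‖ ^ 2

theorem frameDet_perp (v : Fin 2 → ℂ) : frameDet v (perp v) = lengthSq v := by
  simp [frameDet, perp, lengthSq, Complex.mul_conj, Complex.normSq_eq_norm_sq]

theorem frameDet_smul_right (c : ℂ) (a b : Fin 2 → ℂ) : frameDet a (c • b) = c * frameDet a b := by
  simp [frameDet]; ring

theorem frameDet_add_smul_self (c : ℂ) (a b : Fin 2 → ℂ) :
    frameDet a (c • a + b) = frameDet a b := by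
  simp [frameDet]; ring

theorem frameDet_mulVec (g : SL(2, ℂ)) (a b : Fin 2 → ℂ) :
    frameDet (g.1 *ᵥ a) (g.1 *ᵥ b) = frameDet a b := by
  have h := g.2
  rw [Matrix.det_fin_two] at h
  simp only [frameDet, Matrix.mulVec, dotProduct, Fin.sum_univ_two]
  linear_combination (a 0 * b 1 - a 1 * b 0) * h

theorem perp_smul (c : ℂ) (v : Fin 2 → ℂ) : perp (c • v) = (starRingEnd ℂ) c • perp v := by
  ext i; fin_cases i <;> simp [perp]

theorem continuous_perp : Continuous perp := by
  refine continuous_pi fun i => ?_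
  fin_cases i <;> simp only [perp] <;> simp <;> fun_prop

theorem norm_perp_le (v : Fin 2 → ℂ) : ‖perp v‖ ≤ ‖v‖ := by
  refine (pi_norm_le_iff_of_nonneg (norm_nonneg v)).2 fun i => ?_
  fin_cases i
  · simpa [perp] using norm_le_pi_norm v 1
  · simpa [perp] using norm_le_pi_norm v 0

theorem norm_sq_le_lengthSq (v : Fin 2 → ℂ) : ‖v‖ ^ 2 ≤ lengthSq v := by
  have h : ‖v‖ ≤ √(lengthSq v) := by
    refine (pi_norm_le_iff_of_nonneg (Real.sqrt_nonneg _)).2 fun i => Real.le_sqrt_of_sq_le ?_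
    fin_cases i <;> simp [lengthSq]
  have h0 : 0 ≤ lengthSq v := by unfold lengthSq; positivity
  calc ‖v‖ ^ 2 ≤ √(lengthSq v) ^ 2 := by gcongr
    _ = lengthSq v := Real.sq_sqrt h0

theorem lengthSq_le (v : Fin 2 → ℂ) : lengthSq v ≤ 2 * ‖v‖ ^ 2 := by
  have h : ∀ i, ‖v i‖ ^ 2 ≤ ‖v‖ ^ 2 := fun i => by gcongr; exact norm_le_pi_norm v i
  unfold lengthSq
  linarith [h 0, h 1]

theorem lengthSq_pos {v : Fin 2 → ℂ} (hv : v ≠ 0) : 0 < lengthSq v :=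
  lt_of_lt_of_le (pow_pos (norm_pos_iff.2 hv) 2) (norm_sq_le_lengthSq v)

theorem norm_frameDet_le (a b : Fin 2 → ℂ) : ‖frameDet a b‖ ≤ 2 * (‖a‖ * ‖b‖) := by
  have h : ∀ i j, ‖a i * b j‖ ≤ ‖a‖ * ‖b‖ := fun i j => by
    rw [norm_mul]
    exact mul_le_mul (norm_le_pi_norm a i) (norm_le_pi_norm b j) (norm_nonneg _) (norm_nonneg _)
  have := norm_sub_le (a 0 * b 1) (a 1 * b 0)
  unfold frameDet
  linarith [h 0 1, h 1 0]

theorem norm_mulVec_le (A : Matrix (Fin 2) (Fin 2) ℂ) (v : Fin 2 → ℂ) :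
    ‖A *ᵥ v‖ ≤ 2 * ‖entries A‖ * ‖v‖ := by
  refine (pi_norm_le_iff_of_nonneg (by positivity)).2 fun i => ?_
  simp only [Matrix.mulVec, dotProduct, Fin.sum_univ_two]
  have h : ∀ k, ‖A i k * v k‖ ≤ ‖entries A‖ * ‖v‖ := fun k => by
    rw [norm_mul]
    exact mul_le_mul (norm_entry_le A i k) (norm_le_pi_norm v k) (norm_nonneg _) (norm_nonneg _)
  linarith [norm_add_le (A i 0 * v 0) (A i 1 * v 1), h 0, h 1]

theorem specialLinear_mulVec_ne_zero (g : SL(2, ℂ)) {v : Fin 2 → ℂ} (hv : v ≠ 0) :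
    g.1 *ᵥ v ≠ 0 := by
  intro h
  have h1 := frameDet_mulVec g v (perp v)
  rw [h, frameDet_perp] at h1
  have h2 : (lengthSq v : ℂ) = 0 := h1.symm.trans (by simp [frameDet])
  exact (lengthSq_pos hv).ne' (by exact_mod_cast h2)

/-- Averaging over an arithmetic progression is almost insensitive to a shift: up to a rounding
error, the shift is by a multiple of the step, and then only few terms change. -/
theorem norm_sum_shift_sub_le {E : Type*} [SeminormedAddCommGroup E] {F : ℝ → E}
    (hF : ∀ t, ‖F t‖ ≤ 1) {δ η : ℝ} (hδ : 0 < δ)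
    (hη : ∀ t t', |t - t'| ≤ δ → ‖F t - F t'‖ ≤ η) (M : ℕ) (t t' : ℝ) :
    ‖∑ j ∈ Finset.range M, F (t + j * δ) - ∑ j ∈ Finset.range M, F (t' + j * δ)‖ ≤
      2 * (|t - t'| / δ) + M * η := by
  wlog htt : t' ≤ t generalizing t t'
  · rw [norm_sub_rev, abs_sub_comm]
    exact this t' t (le_of_not_ge htt)
  have hstep : ∀ u, ‖∑ j ∈ Finset.range M, F (u + δ + j * δ) -
      ∑ j ∈ Finset.range M, F (u + j * δ)‖ ≤ 2 := by
    intro u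
    rw [← Finset.sum_sub_distrib]
    have : ∀ j : ℕ, F (u + δ + j * δ) - F (u + j * δ) =
        F (u + ((j + 1 : ℕ) : ℝ) * δ) - F (u + j * δ) := fun j => by
      congr 2; push_cast; ring
    rw [Finset.sum_congr rfl fun j _ => this j,
      Finset.sum_range_sub fun j : ℕ => F (u + (j : ℝ) * δ)]
    exact (norm_sub_le _ _).trans (by linarith [hF (u + (M : ℝ) * δ), hF (u + ((0 : ℕ) : ℝ) * δ)])
  have hsteps : ∀ k : ℕ, ‖∑ j ∈ Finset.range M, F (t' + k * δ + j * δ) -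
      ∑ j ∈ Finset.range M, F (t' + j * δ)‖ ≤ 2 * k := by
    intro k
    induction k with
    | zero => simp
    | succ k ih =>
      have h1 := hstep (t' + k * δ)
      have h2 : t' + k * δ + δ = t' + ((k + 1 : ℕ) : ℝ) * δ := by push_cast; ring
      rw [h2] at h1
      refine (norm_sub_le_norm_sub_add_norm_sub _
        (∑ j ∈ Finset.range M, F (t' + k * δ + j * δ)) _).trans ?_
      push_cast at h1 ⊢
      linarith
  set k := ⌊(t - t') / δ⌋₊ with hk
  have hk1 : (k : ℝ) ≤ (t - t') / δ := Nat.floor_le (div_nonneg (by linarith) hδ.le)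
  have hk2 : (t - t') / δ < k + 1 := Nat.lt_floor_add_one _
  rw [le_div_iff₀ hδ] at hk1
  rw [div_lt_iff₀ hδ] at hk2
  have hround : ‖∑ j ∈ Finset.range M, F (t + j * δ) -
      ∑ j ∈ Finset.range M, F (t' + k * δ + j * δ)‖ ≤ M * η := by
    rw [← Finset.sum_sub_distrib]
    refine (norm_sum_le_of_le (n := fun _ => η) _ fun j _ => hη _ _ ?_).trans (by simp)
    rw [abs_le]
    constructor <;> linarith
  have h3 : (k : ℝ) ≤ |t - t'| / δ := by
    rw [abs_of_nonneg (by linarith), le_div_iff₀ hδ]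
    exact hk1
  refine (norm_sub_le_norm_sub_add_norm_sub _
    (∑ j ∈ Finset.range M, F (t' + k * δ + j * δ)) _).trans ?_
  linarith [hsteps k]

theorem one_add_mul_pow_sub_one_le {τ A : ℝ} (hτ : 0 ≤ τ) (hτ1 : τ ≤ 1) (hA : 0 ≤ A) (m : ℕ) :
    (1 + τ * A) ^ m - 1 ≤ τ * ((1 + A) ^ m - 1) := by
  induction m with
  | zero => simp
  | succ m ih =>
    have hB : 0 ≤ (1 + A) ^ m - 1 := sub_nonneg.2 (one_le_pow₀ (by linarith))
    rw [pow_succ, pow_succ]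
    have h1 : 0 ≤ τ * A := mul_nonneg hτ hA
    have h2 := mul_le_mul_of_nonneg_right ih (by linarith : (0 : ℝ) ≤ 1 + τ * A)
    have h3 : τ * ((1 + A) ^ m - 1) * (τ * A) ≤ τ * ((1 + A) ^ m - 1) * A :=
      mul_le_mul_of_nonneg_left (mul_le_of_le_one_left hA hτ1) (mul_nonneg hτ hB)
    nlinarith

theorem sum_exp_neg_le {δ : ℝ} (hδ : 0 < δ) (M : ℕ) :
    ∑ j ∈ Finset.range M, Real.exp (-(j * δ)) ≤ 1 + 1 / δ := by
  have h1 : ∀ j : ℕ, Real.exp (-(j * δ)) = Real.exp (-δ) ^ j := fun j => by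
    rw [← Real.exp_nat_mul]; congr 1; ring
  have h2 : Real.exp (-δ) < 1 := Real.exp_lt_one_iff.2 (by linarith)
  have h3 : Real.exp (-δ) ≤ 1 / (1 + δ) := by
    rw [Real.exp_neg, inv_eq_one_div]
    exact one_div_le_one_div_of_le (by linarith) (by linarith [Real.add_one_le_exp δ])
  have h4 : δ / (1 + δ) ≤ 1 - Real.exp (-δ) := by
    have : δ / (1 + δ) = 1 - 1 / (1 + δ) := by field_simp; ring
    linarith
  simp only [h1]
  calc ∑ j ∈ Finset.range M, Real.exp (-δ) ^ j ≤ (1 - Real.exp (-δ))⁻¹ := by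
        rw [← tsum_geometric_of_lt_one (Real.exp_pos _).le h2]
        exact (summable_geometric_of_lt_one (Real.exp_pos _).le h2).sum_le_tsum _
          fun j _ => by positivity
    _ ≤ (δ / (1 + δ))⁻¹ := inv_anti₀ (by positivity) h4
    _ = 1 + 1 / δ := by field_simp; ring

section Rays

variable {G : Type*} [Group G] (ρ : G →* SL(2, ℂ)) (N : ℕ)

/-- The probability vector attached to the point at distance `t` on the geodesic ray of hyperbolic
space that leaves the base point towards the boundary point `[v]`. -/
noncomputable def rayLaw (v : Fin 2 → ℂ) (t : ℝ) : EllOne G :=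
  frameLaw ρ N v ((Real.exp (-t) : ℂ) • perp v)

/-- The average of `rayLaw` over the points at distances `j / (i + 1)`, `j < (i + 1) ^ 2`: the mesh
tends to zero and the length of the segment tends to infinity. -/
noncomputable def rayAverage (i : ℕ) (v : Fin 2 → ℂ) : EllOne G :=
  ((Finset.range ((i + 1) ^ 2)).card : ℝ)⁻¹ •
    ∑ j ∈ Finset.range ((i + 1) ^ 2), rayLaw ρ N v (j * ((i : ℝ) + 1)⁻¹)

/-- The translate of `rayAverage ρ N i v` by `s`, see `translatedRayAverage_apply`. -/
noncomputable def translatedRayAverage (i : ℕ) (s : G) (v : Fin 2 → ℂ) : EllOne G :=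
  ((Finset.range ((i + 1) ^ 2)).card : ℝ)⁻¹ •
    ∑ j ∈ Finset.range ((i + 1) ^ 2), frameLaw ρ N ((ρ s).1 *ᵥ v)
      ((ρ s).1 *ᵥ ((Real.exp (-(j * ((i : ℝ) + 1)⁻¹)) : ℂ) • perp v))

variable {ρ N}

theorem frameDet_exp_smul_perp_ne_zero {v : Fin 2 → ℂ} (hv : v ≠ 0) (t : ℝ) :
    frameDet v ((Real.exp (-t) : ℂ) • perp v) ≠ 0 := by
  rw [frameDet_smul_right, frameDet_perp]
  have h1 := (lengthSq_pos hv).ne'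
  have h2 := (Real.exp_pos (-t)).ne'
  exact mul_ne_zero (by exact_mod_cast h2) (by exact_mod_cast h1)

theorem rayLaw_smul {c : ℂ} (hc : c ≠ 0) (v : Fin 2 → ℂ) (t : ℝ) :
    rayLaw ρ N (c • v) t = rayLaw ρ N v t := by
  rw [rayLaw, perp_smul, smul_comm, frameLaw_smul hc (by simp), rayLaw]

theorem rayAverage_smul {c : ℂ} (hc : c ≠ 0) (i : ℕ) (v : Fin 2 → ℂ) :
    rayAverage ρ N i (c • v) = rayAverage ρ N i v := by
  simp only [rayAverage, rayLaw_smul hc]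

variable (hN : Summable fun γ : G => (‖entries (ρ γ).1‖ ^ N)⁻¹)
include hN

theorem isProbVector_rayLaw {v : Fin 2 → ℂ} (hv : v ≠ 0) (t : ℝ) :
    IsProbVector (rayLaw ρ N v t) :=
  isProbVector_frameLaw hN (frameDet_exp_smul_perp_ne_zero hv t)

theorem isProbVector_rayAverage {v : Fin 2 → ℂ} (hv : v ≠ 0) (i : ℕ) :
    IsProbVector (rayAverage ρ N i v) :=
  isProbVector_average (by simp) fun _ _ => isProbVector_rayLaw hN hv _

theorem translatedRayAverage_apply {v : Fin 2 → ℂ} (hv : v ≠ 0) (i : ℕ) (s γ : G) :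
    translatedRayAverage ρ N i s v γ = rayAverage ρ N i v (s⁻¹ * γ) := by
  rw [translatedRayAverage, rayAverage, ellOne_average_apply, ellOne_average_apply]
  refine congrArg (_ * ·) (Finset.sum_congr rfl fun j _ => ?_)
  exact frameLaw_mulVec_apply hN s (frameDet_exp_smul_perp_ne_zero hv _) γ

theorem continuousAt_frameLaw {a b : Fin 2 → ℂ} (hab : frameDet a b ≠ 0) :
    ContinuousAt (fun p : (Fin 2 → ℂ) × (Fin 2 → ℂ) => frameLaw ρ N p.1 p.2) (a, b) := by
  let k₁ : (Fin 2 → ℂ) × (Fin 2 → ℂ) → ℝ := fun p =>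
    max (‖frameDet p.1 b / frameDet a b‖ + ‖frameDet p.2 b / frameDet a b‖)
      (‖frameDet a p.1 / frameDet a b‖ + ‖frameDet a p.2 / frameDet a b‖)
  let k₂ : (Fin 2 → ℂ) × (Fin 2 → ℂ) → ℝ := fun p =>
    max (‖frameDet a p.2 / frameDet p.1 p.2‖ + ‖frameDet b p.2 / frameDet p.1 p.2‖)
      (‖frameDet p.1 a / frameDet p.1 p.2‖ + ‖frameDet p.1 b / frameDet p.1 p.2‖)
  let k : (Fin 2 → ℂ) × (Fin 2 → ℂ) → ℝ := fun p => max 1 (max (k₁ p) (k₂ p))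
  have hself : ∀ v, frameDet v v = 0 := fun v => by simp [frameDet]; ring
  have hk1 : k (a, b) = 1 := by simp [k, k₁, k₂, hself, hab]
  have hdet : Continuous fun p : (Fin 2 → ℂ) × (Fin 2 → ℂ) => frameDet p.1 p.2 := by
    unfold frameDet; fun_prop
  have hkc : ContinuousAt k (a, b) := by
    have h1 : ∀ v, Continuous fun p : (Fin 2 → ℂ) × (Fin 2 → ℂ) => frameDet p.1 v :=
      fun v => by unfold frameDet; fun_prop
    have h2 : ∀ v, Continuous fun p : (Fin 2 → ℂ) × (Fin 2 → ℂ) => frameDet p.2 v :=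
      fun v => by unfold frameDet; fun_prop
    have h3 : ∀ v, Continuous fun p : (Fin 2 → ℂ) × (Fin 2 → ℂ) => frameDet v p.1 :=
      fun v => by unfold frameDet; fun_prop
    have h4 : ∀ v, Continuous fun p : (Fin 2 → ℂ) × (Fin 2 → ℂ) => frameDet v p.2 :=
      fun v => by unfold frameDet; fun_prop
    have hd : ∀ f : (Fin 2 → ℂ) × (Fin 2 → ℂ) → ℂ, Continuous f →
        ContinuousAt (fun p => ‖f p / frameDet p.1 p.2‖) (a, b) := fun f hf =>
      (hf.continuousAt.div hdet.continuousAt hab).norm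
    have hc : ∀ f : (Fin 2 → ℂ) × (Fin 2 → ℂ) → ℂ, Continuous f →
        ContinuousAt (fun p => ‖f p / frameDet a b‖) (a, b) := fun f hf =>
      (hf.div_const _).norm.continuousAt
    exact continuousAt_const.max
      ((((hc _ (h1 b)).add (hc _ (h2 b))).max ((hc _ (h3 a)).add (hc _ (h4 a)))).max
        (((hd _ (h4 a)).add (hd _ (h4 b))).max ((hd _ (h1 a)).add (hd _ (h1 b)))))
  have hlim : Tendsto (fun p => k p ^ (2 * N) - 1) (𝓝 (a, b)) (𝓝 0) := by
    have h := (hkc.tendsto.pow (2 * N)).sub_const 1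
    rwa [hk1, one_pow, sub_self] at h
  rw [ContinuousAt, tendsto_iff_norm_sub_tendsto_zero]
  refine squeeze_zero' (Eventually.of_forall fun _ => norm_nonneg _) ?_ hlim
  filter_upwards [hdet.continuousAt.eventually_ne hab] with p hp
  refine norm_frameLaw_sub_le hN hp hab (le_max_left _ _) (fun γ => ?_) (fun γ => ?_)
  · exact (frameSize_le_mul hab p.1 p.2 γ).trans (mul_le_mul_of_nonneg_right
      ((le_max_left _ _).trans (le_max_right _ _)) (frameSize_nonneg _ _ _))
  · exact (frameSize_le_mul hp a b γ).trans (mul_le_mul_of_nonneg_right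
      ((le_max_right _ _).trans (le_max_right _ _)) (frameSize_nonneg _ _ _))

theorem continuousOn_rayAverage (i : ℕ) :
    ContinuousOn (rayAverage ρ N i) {v | v ≠ 0} := by
  intro v hv
  refine ContinuousAt.continuousWithinAt ?_
  unfold rayAverage
  suffices hsum : ContinuousAt (fun v => ∑ j ∈ Finset.range ((i + 1) ^ 2),
      rayLaw ρ N v (j * ((i : ℝ) + 1)⁻¹)) v from
    Tendsto.const_smul hsum _
  refine tendsto_finsetSum _ fun j _ => ?_
  exact ContinuousAt.comp (f := fun v => (v, _ • perp v))
    (continuousAt_frameLaw hN (frameDet_exp_smul_perp_ne_zero hv _))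
    (continuousAt_id.prodMk (Tendsto.const_smul continuous_perp.continuousAt _))

theorem norm_rayLaw_sub_le {v : Fin 2 → ℂ} (hv : v ≠ 0) {t t' δ : ℝ} (h : |t - t'| ≤ δ) :
    ‖rayLaw ρ N v t - rayLaw ρ N v t'‖ ≤ Real.exp δ ^ (2 * N) - 1 := by
  have key : ∀ u u' : ℝ, |u - u'| ≤ δ → ∀ γ : G,
      frameSize ρ v ((Real.exp (-u) : ℂ) • perp v) γ ≤
        Real.exp δ * frameSize ρ v ((Real.exp (-u') : ℂ) • perp v) γ := by
    intro u u' huu γ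
    have hexp : (Real.exp (-u) : ℂ) = (Real.exp (u' - u) : ℂ) * (Real.exp (-u') : ℂ) := by
      rw [← Complex.ofReal_mul, ← Real.exp_add]; congr 2; ring
    have h1 := frameSize_combination_le (ρ := ρ) (a := v)
      (b := (Real.exp (-u') : ℂ) • perp v) (α := 1) (β := 0) (α' := 0)
      (β' := (Real.exp (u' - u) : ℂ)) (K := Real.exp δ) ?_ ?_ γ
    · simpa [hexp, smul_smul] using h1
    · have : 0 ≤ δ := (abs_nonneg _).trans h
      simpa using this
    · rw [norm_zero, zero_add, Complex.norm_real, Real.norm_of_nonneg (Real.exp_pos _).le]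
      exact Real.exp_le_exp.2 (by linarith [(abs_le.1 huu).1])
  exact norm_frameLaw_sub_le hN (frameDet_exp_smul_perp_ne_zero hv t)
    (frameDet_exp_smul_perp_ne_zero hv t') (Real.one_le_exp ((abs_nonneg _).trans h))
    (key t t' h) (key t' t (by rwa [abs_sub_comm]))

/-- The element `s` carries the ray towards `[v]` to a ray asymptotic to the ray towards `[s v]`,
with parameter shifted by an amount `θ` that is bounded uniformly in `v`; the distance between the
two decays exponentially. -/
theorem norm_frameLaw_mulVec_sub_rayLaw_le (s : G) :
    ∃ A B : ℝ, 0 ≤ B ∧ ∀ v : Fin 2 → ℂ, v ≠ 0 → ∃ θ : ℝ, |θ| ≤ A ∧ ∀ t : ℝ, 0 ≤ t →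
      ‖frameLaw ρ N ((ρ s).1 *ᵥ v) ((ρ s).1 *ᵥ ((Real.exp (-t) : ℂ) • perp v)) -
        rayLaw ρ N ((ρ s).1 *ᵥ v) (t + θ)‖ ≤ B * Real.exp (-t) := by
  -- `L` bounds the distortion of lengths by `s` and `s⁻¹`. In the expansion
  -- `s v⊥ = c • w + κ • w⊥`, where `w = s v`, the number `A` bounds `κ`, `κ⁻¹` and `‖c‖`.
  set L : ℝ := 2 * ‖entries (ρ s).1‖ with hL
  have hL1 : 1 ≤ L := by linarith [half_le_norm_entries (ρ s)]
  set A : ℝ := 2 * L ^ 2 with hA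
  have hA1 : 1 ≤ A := by nlinarith
  refine ⟨Real.log A, (1 + A) ^ (2 * N) - 1,
    sub_nonneg.2 (one_le_pow₀ (by linarith)), fun v hv => ?_⟩
  set w := (ρ s).1 *ᵥ v with hw
  set u := (ρ s).1 *ᵥ perp v with hu
  have hw0 : w ≠ 0 := specialLinear_mulVec_ne_zero (ρ s) hv
  have hwv : ‖w‖ ≤ L * ‖v‖ := norm_mulVec_le _ _
  have hvw : ‖v‖ ≤ L * ‖w‖ := by
    have h1 : v = (ρ s)⁻¹.1 *ᵥ w := by
      rw [hw, Matrix.mulVec_mulVec, ← Matrix.SpecialLinearGroup.coe_mul, inv_mul_cancel,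
        Matrix.SpecialLinearGroup.coe_one, Matrix.one_mulVec]
    calc ‖v‖ = ‖(ρ s)⁻¹.1 *ᵥ w‖ := by rw [← h1]
      _ ≤ 2 * ‖entries (ρ s)⁻¹.1‖ * ‖w‖ := norm_mulVec_le _ _
      _ ≤ L * ‖w‖ := by
        exact mul_le_mul_of_nonneg_right
          (mul_le_mul_of_nonneg_left (norm_entries_inv (ρ s)) zero_le_two) (norm_nonneg w)
  have huv : ‖u‖ ≤ L * ‖v‖ := (norm_mulVec_le _ _).trans (by
    have := norm_perp_le v
    gcongr)
  have hsv := lengthSq_pos hv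
  have hsw := lengthSq_pos hw0
  have hswv : lengthSq w ≤ A * lengthSq v := by
    calc lengthSq w ≤ 2 * ‖w‖ ^ 2 := lengthSq_le w
      _ ≤ 2 * (L * ‖v‖) ^ 2 := by gcongr
      _ = A * ‖v‖ ^ 2 := by ring
      _ ≤ A * lengthSq v := by gcongr; exact norm_sq_le_lengthSq v
  have hsvw : lengthSq v ≤ A * lengthSq w := by
    calc lengthSq v ≤ 2 * ‖v‖ ^ 2 := lengthSq_le v
      _ ≤ 2 * (L * ‖w‖) ^ 2 := by gcongr
      _ = A * ‖w‖ ^ 2 := by ring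
      _ ≤ A * lengthSq w := by gcongr; exact norm_sq_le_lengthSq w
  set κ : ℝ := lengthSq v / lengthSq w with hκ
  have hκ0 : 0 < κ := div_pos hsv hsw
  set c : ℂ := frameDet u (perp w) / lengthSq w with hc
  have hcA : ‖c‖ ≤ A := by
    rw [hc, norm_div, Complex.norm_real, Real.norm_of_nonneg hsw.le, div_le_iff₀ hsw]
    calc ‖frameDet u (perp w)‖ ≤ 2 * (‖u‖ * ‖perp w‖) := norm_frameDet_le _ _
      _ ≤ 2 * ((L * (L * ‖w‖)) * ‖w‖) := by
        have h1 := norm_perp_le w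
        have h2 : ‖u‖ ≤ L * (L * ‖w‖) := huv.trans (by gcongr)
        gcongr
      _ = A * ‖w‖ ^ 2 := by ring
      _ ≤ A * lengthSq w := by gcongr; exact norm_sq_le_lengthSq w
  have hexpand : u = c • w + (κ : ℂ) • perp w := by
    have hdet : frameDet w (perp w) ≠ 0 := by
      rw [frameDet_perp]; exact_mod_cast hsw.ne'
    have h := frame_expansion hdet u
    -- The coefficient of `w⊥` is a quotient of squared lengths because `s` has determinant one.
    rwa [frameDet_perp, hw, hu, frameDet_mulVec, frameDet_perp, ← hw, ← hu, ← Complex.ofReal_div,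
      ← hκ, ← hc] at h
  refine ⟨-Real.log κ, ?_, fun t ht => ?_⟩
  · rw [abs_neg, abs_le]
    constructor
    · rw [← Real.log_inv]
      refine Real.log_le_log (by positivity) ?_
      rw [hκ, inv_le_comm₀ (by positivity) (by positivity), inv_div, div_le_iff₀ hsv]
      exact hswv
    · refine Real.log_le_log hκ0 ?_
      rwa [hκ, div_le_iff₀ hsw]
  · have hτ0 := Real.exp_pos (-t)
    have hτ1 : Real.exp (-t) ≤ 1 := Real.exp_le_one_iff.2 (by linarith)
    set τ := Real.exp (-t) with hτ
    have hb : (Real.exp (-(t + -Real.log κ)) : ℂ) • perp w = ((τ : ℂ) * κ) • perp w := by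
      rw [neg_add, neg_neg, Real.exp_add, Real.exp_log hκ0, Complex.ofReal_mul]
    have ha : (ρ s).1 *ᵥ ((τ : ℂ) • perp v) = ((τ : ℂ) * c) • w + ((τ : ℂ) * κ) • perp w := by
      rw [Matrix.mulVec_smul, ← hu, hexpand, smul_add, smul_smul, smul_smul]
    rw [rayLaw, hb, ha]
    set b := ((τ : ℂ) * κ) • perp w with hbdef
    have hdb : frameDet w b ≠ 0 := by
      rw [← hb]; exact frameDet_exp_smul_perp_ne_zero hw0 _
    have hda : frameDet w (((τ : ℂ) * c) • w + b) ≠ 0 := by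
      rwa [frameDet_add_smul_self]
    have hτc : ‖(τ : ℂ) * c‖ ≤ τ * A := by
      rw [norm_mul, Complex.norm_real, Real.norm_of_nonneg hτ0.le]
      gcongr
    have hk : 1 ≤ 1 + τ * A := by nlinarith
    have h1 := norm_frameLaw_sub_le hN hda hdb hk (fun γ => ?_) (fun γ => ?_)
    · refine h1.trans ((one_add_mul_pow_sub_one_le hτ0.le hτ1 (by linarith) _).trans ?_)
      rw [mul_comm]
    · have h := frameSize_combination_le (ρ := ρ) (a := w) (b := b) (α := 1) (β := 0)
        (α' := (τ : ℂ) * c) (β' := 1) (K := 1 + τ * A) (by simpa using hτc) (by simpa using hk) γ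
      simpa using h
    · have h := frameSize_combination_le (ρ := ρ) (a := w) (b := ((τ : ℂ) * c) • w + b) (α := 1)
        (β := 0) (α' := -((τ : ℂ) * c)) (β' := 1) (K := 1 + τ * A)
        (by simpa using hτc) (by simpa using hk) γ
      simpa using h

/-- The averages along rays are asymptotically equivariant, uniformly in the boundary point. -/
theorem tendsto_norm_translatedRayAverage_sub (s : G) :
    ∃ bound : ℕ → ℝ, Tendsto bound atTop (𝓝 0) ∧ ∀ i, ∀ v : Fin 2 → ℂ, v ≠ 0 →
      ‖translatedRayAverage ρ N i s v - rayAverage ρ N i ((ρ s).1 *ᵥ v)‖ ≤ bound i := by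
  obtain ⟨A, B, hB, hAB⟩ := norm_frameLaw_mulVec_sub_rayLaw_le hN s
  refine ⟨fun i => B * (2 * ((i : ℝ) + 1)⁻¹) + (2 * A * ((i : ℝ) + 1)⁻¹ +
    (Real.exp ((i : ℝ) + 1)⁻¹ ^ (2 * N) - 1)), ?_, fun i v hv => ?_⟩
  · have h0 : Tendsto (fun i : ℕ => ((i : ℝ) + 1)⁻¹) atTop (𝓝 0) :=
      tendsto_inv_atTop_zero.comp (tendsto_natCast_atTop_atTop.atTop_add tendsto_const_nhds)
    have h1 := ((h0.const_mul 2).const_mul B).add ((h0.const_mul (2 * A)).add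
      ((((Real.continuous_exp.tendsto 0).comp h0).pow (2 * N)).sub_const 1))
    simpa using h1
  · obtain ⟨θ, hθ, hv'⟩ := hAB v hv
    set δ : ℝ := ((i : ℝ) + 1)⁻¹ with hδ
    have hδ0 : 0 < δ := by positivity
    have hδ1 : δ ≤ 1 := inv_le_one_of_one_le₀ (by linarith [Nat.cast_nonneg (α := ℝ) i])
    set w := (ρ s).1 *ᵥ v with hw
    have hw0 : w ≠ 0 := specialLinear_mulVec_ne_zero (ρ s) hv
    set M := (i + 1) ^ 2 with hM
    have hMδ : (M : ℝ)⁻¹ = δ ^ 2 := by rw [hM, hδ]; push_cast; rw [inv_pow]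
    have hM0 : (M : ℝ) ≠ 0 := by positivity
    rw [translatedRayAverage, rayAverage, Finset.card_range, ← smul_sub, norm_smul,
      Real.norm_of_nonneg (by positivity)]
    have hshift := norm_sum_shift_sub_le (F := rayLaw ρ N w)
      (fun t => (isProbVector_rayLaw hN hw0 t).norm_eq_one.le) hδ0
      (fun t t' h => norm_rayLaw_sub_le hN hw0 h) M θ 0
    have hfirst : ‖∑ j ∈ Finset.range M,
        frameLaw ρ N w ((ρ s).1 *ᵥ ((Real.exp (-(j * δ)) : ℂ) • perp v)) -
        ∑ j ∈ Finset.range M, rayLaw ρ N w (θ + j * δ)‖ ≤ B * (1 + 1 / δ) := by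
      rw [← Finset.sum_sub_distrib]
      refine (norm_sum_le_of_le (n := fun j : ℕ => B * Real.exp (-(j * δ))) _
        fun j _ => ?_).trans ?_
      · rw [add_comm θ]
        exact hv' _ (by positivity)
      · rw [← Finset.mul_sum]
        exact mul_le_mul_of_nonneg_left (sum_exp_neg_le hδ0 M) hB
    simp only [zero_add, sub_zero] at hshift
    have htot := (norm_sub_le_norm_sub_add_norm_sub _ _ _).trans (add_le_add hfirst hshift)
    refine (mul_le_mul_of_nonneg_left htot (by positivity)).trans ?_
    have h1 : δ ^ 2 * (B * (1 + 1 / δ)) = B * (δ * δ + δ) := by field_simp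
    have h2 : δ ^ 2 * (2 * (|θ| / δ)) = 2 * |θ| * δ := by field_simp
    have h3 : δ ^ 2 * (M * (Real.exp δ ^ (2 * N) - 1)) = Real.exp δ ^ (2 * N) - 1 := by
      rw [← hMδ, inv_mul_cancel_left₀ hM0]
    have h4 : B * (δ * δ + δ) ≤ B * (2 * δ) := mul_le_mul_of_nonneg_left (by nlinarith) hB
    have h5 : 2 * |θ| * δ ≤ 2 * A * δ := by gcongr
    change (M : ℝ)⁻¹ * _ ≤ B * (2 * δ) + (2 * A * δ + (Real.exp δ ^ (2 * N) - 1))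
    rw [hMδ, mul_add (δ ^ 2), mul_add (δ ^ 2), h1, h2, h3]
    linarith

end Rays

/-! ### Factorization of binary forms into linear forms -/

open MvPolynomial in
/-- The linear form `v₀ X + v₁ Y`. -/
noncomputable def linearForm (v : Fin 2 → ℂ) : MvPolynomial (Fin 2) ℂ :=
  C (v 0) * X 0 + C (v 1) * X 1

theorem linearForm_isHomogeneous (v : Fin 2 → ℂ) : (linearForm v).IsHomogeneous 1 :=
  (MvPolynomial.isHomogeneous_C_mul_X _ _).add (MvPolynomial.isHomogeneous_C_mul_X _ _)

theorem substitution_linearForm (g : Matrix (Fin 2) (Fin 2) ℂ) (v : Fin 2 → ℂ) :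
    substitution g (linearForm v) = linearForm (g *ᵥ v) := by
  simp [substitution, linearForm, Matrix.mulVec, dotProduct, MvPolynomial.algebraMap_eq]
  ring

theorem linearForm_smul (c : ℂ) (v : Fin 2 → ℂ) :
    linearForm (c • v) = MvPolynomial.C c * linearForm v := by
  simp [linearForm]; ring

theorem coeff_linearForm (v : Fin 2 → ℂ) (i : Fin 2) :
    (linearForm v).coeff (Finsupp.single i 1) = v i := by
  fin_cases i <;>
    simp [linearForm, MvPolynomial.coeff_C_mul, MvPolynomial.coeff_X, Finsupp.single_left_inj]

theorem linearForm_injective : Function.Injective linearForm := by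
  intro v w h
  ext i
  rw [← coeff_linearForm v, h, coeff_linearForm]

theorem linearForm_ne_zero {v : Fin 2 → ℂ} (hv : v ≠ 0) : linearForm v ≠ 0 := by
  intro h
  apply hv
  ext i
  rw [← coeff_linearForm v, h]
  rfl

theorem linearForm_irreducible {v : Fin 2 → ℂ} (hv : v ≠ 0) : Irreducible (linearForm v) := by
  refine MvPolynomial.irreducible_of_totalDegree_eq_one
    ((linearForm_isHomogeneous v).totalDegree (linearForm_ne_zero hv)) fun x hx => ?_
  rw [isUnit_iff_ne_zero]
  rintro rfl
  apply hv
  ext i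
  rw [← coeff_linearForm v]
  exact zero_dvd_iff.1 (hx _)

theorem exists_smul_eq_of_associated_linearForm {v w : Fin 2 → ℂ}
    (h : Associated (linearForm v) (linearForm w)) : ∃ c : ℂ, c ≠ 0 ∧ w = c • v := by
  obtain ⟨u, hu⟩ := h
  obtain ⟨c, hc, huc⟩ := MvPolynomial.isUnit_iff_eq_C_of_isReduced.1 u.isUnit
  refine ⟨c, hc.ne_zero, linearForm_injective ?_⟩
  rw [← hu, huc, linearForm_smul, mul_comm]

theorem prod_linearForm_isHomogeneous {n : ℕ} (v : Fin n → Fin 2 → ℂ) :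
    (∏ i, linearForm (v i)).IsHomogeneous n := by
  have h := MvPolynomial.IsHomogeneous.prod Finset.univ (fun i => linearForm (v i)) (fun _ => 1)
    fun i _ => linearForm_isHomogeneous (v i)
  simpa using h

section Dehomogenize

open Polynomial

/-- The dehomogenization `P(X, 1)` of a polynomial in two variables. -/
noncomputable def dehomogenize : MvPolynomial (Fin 2) ℂ →ₐ[ℂ] ℂ[X] :=
  MvPolynomial.aeval ![X, 1]

theorem dehomogenize_formEquiv (n : ℕ) (c : Fin (n + 1) → ℂ) :
    dehomogenize (formEquiv ℂ n c).1 = ∑ k : Fin (n + 1), monomial (n - (k : ℕ)) (c k) := by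
  change dehomogenize (∑ k, MvPolynomial.monomial (formExponent n k) (c k)) = _
  rw [map_sum]
  refine Finset.sum_congr rfl fun k _ => ?_
  rw [dehomogenize, MvPolynomial.aeval_monomial, formExponent, Finsupp.prod_add_index',
    Finsupp.prod_single_index, Finsupp.prod_single_index]
  · simp [C_mul_X_pow_eq_monomial, Polynomial.algebraMap_eq]
  all_goals simp [pow_add]

theorem dehomogenize_injOn (n : ℕ) {P Q : MvPolynomial (Fin 2) ℂ} (hP : P.IsHomogeneous n)
    (hQ : Q.IsHomogeneous n) (h : dehomogenize P = dehomogenize Q) : P = Q := by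
  obtain ⟨c, hc⟩ := (formEquiv ℂ n).surjective ⟨P, hP⟩
  obtain ⟨d, hd⟩ := (formEquiv ℂ n).surjective ⟨Q, hQ⟩
  have hc' : P = (formEquiv ℂ n c).1 := by rw [hc]
  have hd' : Q = (formEquiv ℂ n d).1 := by rw [hd]
  rw [hc', hd', dehomogenize_formEquiv, dehomogenize_formEquiv] at h
  have hcd : c = d := by
    ext k
    have hk : ∀ b : Fin (n + 1) → ℂ,
        (∑ l : Fin (n + 1), monomial (n - (l : ℕ)) (b l)).coeff (n - (k : ℕ)) = b k := by
      intro b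
      rw [finsetSum_coeff, Finset.sum_eq_single k]
      · simp
      · intro l _ hl
        rw [coeff_monomial, if_neg]
        intro h
        exact hl (Fin.ext (by omega))
      · simp
    rw [← hk c, h, hk d]
  rw [hc', hd', hcd]

theorem natDegree_dehomogenize_le {n : ℕ} {P : MvPolynomial (Fin 2) ℂ} (hP : P.IsHomogeneous n) :
    (dehomogenize P).natDegree ≤ n := by
  obtain ⟨c, hc⟩ := (formEquiv ℂ n).surjective ⟨P, hP⟩
  have hc' : P = (formEquiv ℂ n c).1 := by rw [hc]
  rw [hc', dehomogenize_formEquiv]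
  exact natDegree_sum_le_of_forall_le _ _ fun k _ =>
    (natDegree_monomial_le _).trans (Nat.sub_le _ _)

theorem exists_fin_of_card_eq {α : Type*} {n : ℕ} (S : Multiset α) (hS : S.card = n) :
    ∃ v : Fin n → α, Finset.univ.val.map v = S := by
  obtain ⟨L, rfl⟩ := Quot.exists_rep S
  change L.length = n at hS
  subst hS
  exact ⟨L.get, (Fin.univ_val_map L.get).trans (by rw [List.ofFn_get]; rfl)⟩

theorem exists_prod_linearForm {n : ℕ} {P : MvPolynomial (Fin 2) ℂ} (hP : P.IsHomogeneous n)
    (hP0 : P ≠ 0) :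
    ∃ v : Fin n → Fin 2 → ℂ, (∀ i, v i ≠ 0) ∧ Associated P (∏ i, linearForm (v i)) := by
  set p := dehomogenize P with hp
  have hp0 : p ≠ 0 := fun h => hP0 (dehomogenize_injOn n hP
    (MvPolynomial.isHomogeneous_zero _ _ _) (by rw [← hp, h, map_zero]))
  have hsplit : p = C p.leadingCoeff * (p.roots.map fun a => X - C a).prod :=
    (IsAlgClosed.splits p).eq_prod_roots
  have hcard : p.roots.card ≤ n := (card_roots' p).trans (natDegree_dehomogenize_le hP)
  obtain ⟨v, hv⟩ := exists_fin_of_card_eq (n := n)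
    (p.roots.map (fun a => (![1, -a] : Fin 2 → ℂ)) +
      Multiset.replicate (n - p.roots.card) (![0, 1] : Fin 2 → ℂ)) (by simp; omega)
  have hprod : ∏ i, linearForm (v i) = ((p.roots.map fun a => linearForm ![1, -a]).prod *
      linearForm ![0, 1] ^ (n - p.roots.card)) := by
    have : ∏ i, linearForm (v i) = ((Finset.univ.val.map v).map linearForm).prod := by
      rw [Multiset.map_map]; rfl
    rw [this, hv, Multiset.map_add, Multiset.prod_add, Multiset.map_map, Multiset.map_replicate,
      Multiset.prod_replicate]
    rfl
  -- A root `a` of `P(X, 1)` gives the factor `X - a * Y`; the missing degree is made up by powers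
  -- of `Y`, the roots at infinity.
  refine ⟨v, fun i => ?_, ?_⟩
  · have hi : v i ∈ Finset.univ.val.map v := Multiset.mem_map_of_mem v (Finset.mem_univ i)
    rw [hv, Multiset.mem_add, Multiset.mem_map, Multiset.mem_replicate] at hi
    intro h
    rcases hi with ⟨a, -, ha⟩ | ⟨-, ha⟩
    · have := congrFun (ha.trans h) 0
      simp at this
    · have := congrFun (ha.symm.trans h) 1
      simp at this
  · have hu : IsUnit (MvPolynomial.C p.leadingCoeff : MvPolynomial (Fin 2) ℂ) :=
      (isUnit_iff_ne_zero.2 (leadingCoeff_ne_zero.2 hp0)).map MvPolynomial.C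
    have heq : P = MvPolynomial.C p.leadingCoeff * ∏ i, linearForm (v i) := by
      refine dehomogenize_injOn n hP ?_ ?_
      · exact (prod_linearForm_isHomogeneous v).C_mul _
      · rw [← hp, map_mul, hprod, map_mul, map_pow, map_multiset_prod, Multiset.map_map]
        have h1 : ∀ a : ℂ, dehomogenize (linearForm ![1, -a]) = X - C a := fun a => by
          simp [dehomogenize, linearForm, sub_eq_add_neg]
        have h2 : dehomogenize (linearForm ![0, 1]) = 1 := by
          simp [dehomogenize, linearForm]
        have h3 : dehomogenize (MvPolynomial.C p.leadingCoeff) = C p.leadingCoeff := by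
          simp [dehomogenize]
        rw [h2, h3, one_pow, mul_one]
        simp only [Function.comp_def, h1]
        exact hsplit
    rw [heq]
    exact associated_unit_mul_left _ _ hu

end Dehomogenize

/-- Unique factorization: a scale-invariant function has the same sum over the linear factors in any
two factorizations of a binary form. -/
theorem sum_eq_of_associated_prod_linearForm {n : ℕ} {E : Type*} [AddCommMonoid E]
    {f : (Fin 2 → ℂ) → E} (hf : ∀ c : ℂ, c ≠ 0 → ∀ v, f (c • v) = f v)
    {v w : Fin n → Fin 2 → ℂ} (hv : ∀ i, v i ≠ 0) (hw : ∀ i, w i ≠ 0)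
    (h : Associated (∏ i, linearForm (v i)) (∏ i, linearForm (w i))) :
    ∑ i, f (v i) = ∑ i, f (w i) := by
  have hirr : ∀ v : Fin n → Fin 2 → ℂ, (∀ i, v i ≠ 0) →
      ∀ x ∈ Finset.univ.val.map fun i => linearForm (v i), Irreducible x := by
    intro v hv x hx
    obtain ⟨i, -, rfl⟩ := Multiset.mem_map.1 hx
    exact linearForm_irreducible (hv i)
  have hrel := UniqueFactorizationMonoid.factors_unique (hirr v hv) (hirr w hw) h
  rw [Multiset.rel_map] at hrel
  have hrel' : Multiset.Rel (· = ·) (Finset.univ.val.map fun i => f (v i))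
      (Finset.univ.val.map fun i => f (w i)) := by
    rw [Multiset.rel_map]
    refine hrel.mono fun i _ j _ hij => ?_
    obtain ⟨c, hc, h⟩ := exists_smul_eq_of_associated_linearForm hij
    rw [h, hf c hc]
  exact congrArg Multiset.sum (Multiset.rel_eq.1 hrel')

/-! ### Averaging over the roots of a binary form -/

/-- The form with coefficient vector `c` is, up to a nonzero scalar, the product of the linear forms
given by the nonzero vectors `v i`; their classes in the projective line are the `n` roots of the
form, with multiplicities. -/
structure HasRoots {n : ℕ} (c : Fin (n + 1) → ℂ) (v : Fin n → Fin 2 → ℂ) : Prop where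
  ne_zero : ∀ i, v i ≠ 0
  associated : Associated (formEquiv ℂ n c).1 (∏ i, linearForm (v i))

theorem exists_hasRoots {n : ℕ} {c : Fin (n + 1) → ℂ} (hc : c ≠ 0) : ∃ v, HasRoots c v := by
  obtain ⟨v, h, h'⟩ := exists_prod_linearForm (formEquiv ℂ n c).2 (by
    simpa using hc)
  exact ⟨v, h, h'⟩

theorem HasRoots.smul {n : ℕ} {c : Fin (n + 1) → ℂ} {v : Fin n → Fin 2 → ℂ} (h : HasRoots c v)
    {a : ℂ} (ha : a ≠ 0) : HasRoots (a • c) v := by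
  refine ⟨h.ne_zero, Associated.trans ?_ h.associated⟩
  have hu : IsUnit (MvPolynomial.C a : MvPolynomial (Fin 2) ℂ) :=
    (isUnit_iff_ne_zero.2 ha).map MvPolynomial.C
  have : (formEquiv ℂ n (a • c)).1 = MvPolynomial.C a * (formEquiv ℂ n c).1 := by
    rw [map_smul, ← MvPolynomial.smul_eq_C_mul]; rfl
  rw [this]
  exact associated_unit_mul_left _ _ hu

theorem formEquiv_coordRep {F : Type*} [Field F] {n : ℕ} (g : SL(2, F)) (c : Fin (n + 1) → F) :
    (formEquiv F n (coordRep F n g c)).1 = substitution g.1 (formEquiv F n c).1 := by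
  simp only [coordRep, LinearMap.comp_apply, LinearEquiv.coe_coe, LinearEquiv.apply_symm_apply]
  rfl

theorem HasRoots.coordRep {n : ℕ} {c : Fin (n + 1) → ℂ} {v : Fin n → Fin 2 → ℂ}
    (h : HasRoots c v) (g : SL(2, ℂ)) :
    HasRoots (coordRep ℂ n g c) fun i => g.1 *ᵥ v i := by
  constructor
  · intro i hi
    apply h.ne_zero i
    have h1 : (g⁻¹).1 *ᵥ (g.1 *ᵥ v i) = v i := by
      rw [Matrix.mulVec_mulVec, ← Matrix.SpecialLinearGroup.coe_mul, inv_mul_cancel,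
        Matrix.SpecialLinearGroup.coe_one, Matrix.one_mulVec]
    rw [← h1, hi, Matrix.mulVec_zero]
  · have h2 : ∏ i, linearForm (g.1 *ᵥ v i) = substitution g.1 (∏ i, linearForm (v i)) := by
      rw [map_prod]
      exact Finset.prod_congr rfl fun i _ => (substitution_linearForm _ _).symm
    rw [formEquiv_coordRep, h2]
    exact h.associated.map (substitution g.1)

section RootAverage

variable {E : Type*} [NormedAddCommGroup E] [NormedSpace ℝ E] {n : ℕ}

open Classical in
/-- The average of `f` over the roots of the form with coefficient vector `c`; meaningful if `c ≠ 0`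
and `f` is invariant under scaling, see `HasRoots.rootAverage_eq`. -/
noncomputable def rootAverage (f : (Fin 2 → ℂ) → E) (c : Fin (n + 1) → ℂ) : E :=
  if h : ∃ v, HasRoots c v then ((Finset.univ : Finset (Fin n)).card : ℝ)⁻¹ • ∑ i, f (h.choose i)
  else 0

theorem HasRoots.rootAverage_eq {f : (Fin 2 → ℂ) → E}
    (hf : ∀ c : ℂ, c ≠ 0 → ∀ v, f (c • v) = f v) {c : Fin (n + 1) → ℂ} {v : Fin n → Fin 2 → ℂ}
    (h : HasRoots c v) :
    rootAverage f c = ((Finset.univ : Finset (Fin n)).card : ℝ)⁻¹ • ∑ i, f (v i) := by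
  have h' : ∃ v, HasRoots c v := ⟨v, h⟩
  rw [rootAverage, dif_pos h']
  congr 1
  exact sum_eq_of_associated_prod_linearForm hf h'.choose_spec.ne_zero h.ne_zero
    (h'.choose_spec.associated.symm.trans h.associated)

theorem rootAverage_smul {f : (Fin 2 → ℂ) → E} (hf : ∀ c : ℂ, c ≠ 0 → ∀ v, f (c • v) = f v)
    {a : ℂ} (ha : a ≠ 0) {c : Fin (n + 1) → ℂ} (hc : c ≠ 0) :
    rootAverage f (a • c) = rootAverage f c := by
  obtain ⟨v, hv⟩ := exists_hasRoots hc
  rw [hv.rootAverage_eq hf, (hv.smul ha).rootAverage_eq hf]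

/-- The coefficient vector of the product of the linear forms given by the vectors `v i`. -/
noncomputable def prodCoeff (v : Fin n → Fin 2 → ℂ) : Fin (n + 1) → ℂ :=
  (formEquiv ℂ n).symm ⟨∏ i, linearForm (v i), prod_linearForm_isHomogeneous v⟩

theorem formEquiv_prodCoeff (v : Fin n → Fin 2 → ℂ) :
    (formEquiv ℂ n (prodCoeff v)).1 = ∏ i, linearForm (v i) := by
  rw [prodCoeff, LinearEquiv.apply_symm_apply]

theorem hasRoots_prodCoeff {v : Fin n → Fin 2 → ℂ} (hv : ∀ i, v i ≠ 0) :
    HasRoots (prodCoeff v) v :=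
  ⟨hv, by rw [formEquiv_prodCoeff]⟩

theorem prodCoeff_ne_zero {v : Fin n → Fin 2 → ℂ} (hv : ∀ i, v i ≠ 0) : prodCoeff v ≠ 0 := by
  intro h
  have h1 := formEquiv_prodCoeff v
  rw [h, map_zero] at h1
  exact (Finset.prod_ne_zero_iff.2 fun i _ => linearForm_ne_zero (hv i)) h1.symm

theorem continuous_prodCoeff : Continuous (prodCoeff : (Fin n → Fin 2 → ℂ) → Fin (n + 1) → ℂ) := by
  have hlin : ∀ (i : Fin n) (d : Fin 2 →₀ ℕ),
      Continuous fun v : Fin n → Fin 2 → ℂ => (linearForm (v i)).coeff d := by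
    intro i d
    simp only [linearForm, MvPolynomial.coeff_add, MvPolynomial.coeff_C_mul]
    fun_prop
  have h : ∀ (s : Finset (Fin n)) (d : Fin 2 →₀ ℕ),
      Continuous fun v : Fin n → Fin 2 → ℂ => (∏ i ∈ s, linearForm (v i)).coeff d := by
    classical
    intro s
    induction s using Finset.induction_on with
    | empty => intro d; simpa using continuous_const
    | insert i s hi ih =>
      intro d
      simp only [Finset.prod_insert hi, MvPolynomial.coeff_mul]
      exact continuous_finsetSum _ fun x _ => (hlin i x.1).mul (ih x.2)
  exact continuous_pi fun k => h Finset.univ (formExponent n k)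

/-- Parametrization of the unit sphere of coefficient vectors by unit vectors giving the roots, and
a phase. -/
noncomputable def sphereParam
    (p : Metric.sphere (0 : ℂ) 1 × (Fin n → Metric.sphere (0 : Fin 2 → ℂ) 1)) :
    Metric.sphere (0 : Fin (n + 1) → ℂ) 1 :=
  ⟨(p.1.1 * (‖prodCoeff fun i => (p.2 i).1‖ : ℂ)⁻¹) • prodCoeff fun i => (p.2 i).1, by
    have h := prodCoeff_ne_zero (v := fun i => (p.2 i).1) fun i => ne_zero_of_mem_unit_sphere _
    have h1 : ‖p.1.1‖ = 1 := by simp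
    rw [mem_sphere_zero_iff_norm, norm_smul, norm_mul, h1, norm_inv, Complex.norm_real,
      norm_norm, one_mul, inv_mul_cancel₀ (norm_ne_zero_iff.2 h)]⟩

theorem isQuotientMap_sphereParam : IsQuotientMap (sphereParam (n := n)) := by
  have hcont : Continuous (sphereParam (n := n)) := by
    have h1 : Continuous fun p : Metric.sphere (0 : ℂ) 1 × (Fin n → Metric.sphere (0 : Fin 2 → ℂ) 1)
        => prodCoeff fun i => (p.2 i).1 := continuous_prodCoeff.comp (by fun_prop)
    refine Continuous.subtype_mk (Continuous.smul (Continuous.mul (by fun_prop)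
      (Continuous.inv₀ (Complex.continuous_ofReal.comp h1.norm) fun p => ?_)) h1) _
    have h := prodCoeff_ne_zero (v := fun i => (p.2 i).1) fun i => ne_zero_of_mem_unit_sphere _
    exact Complex.ofReal_ne_zero.2 (norm_ne_zero_iff.2 h)
  refine hcont.isClosedMap.isQuotientMap hcont fun c => ?_
  have hc : c.1 ≠ 0 := ne_zero_of_mem_unit_sphere c
  have hc1 : ‖c.1‖ = 1 := by simp
  obtain ⟨v, hv⟩ := exists_hasRoots hc
  have hvn : ∀ i, (‖v i‖ : ℂ) ≠ 0 := fun i => by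
    exact_mod_cast norm_ne_zero_iff.2 (hv.ne_zero i)
  let w : Fin n → Metric.sphere (0 : Fin 2 → ℂ) 1 := fun i => ⟨(‖v i‖ : ℂ)⁻¹ • v i, by
    rw [mem_sphere_zero_iff_norm, norm_smul, norm_inv, Complex.norm_real, norm_norm,
      inv_mul_cancel₀ (norm_ne_zero_iff.2 (hv.ne_zero i))]⟩
  have hw : ∏ i, linearForm (w i).1 =
      MvPolynomial.C (∏ i, (‖v i‖ : ℂ)⁻¹) * ∏ i, linearForm (v i) := by
    simp only [w, linearForm_smul, Finset.prod_mul_distrib, map_prod]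
  obtain ⟨u, hu⟩ := hv.associated
  obtain ⟨a, ha, hua⟩ := MvPolynomial.isUnit_iff_eq_C_of_isReduced.1 u.isUnit
  -- The product of the normalized factors is a scalar multiple of the given form.
  obtain ⟨b, hb⟩ : ∃ b : ℂ, prodCoeff (fun i => (w i).1) = b • c.1 := by
    refine ⟨(∏ i, (‖v i‖ : ℂ)⁻¹) * a, (formEquiv ℂ n).injective (Subtype.ext ?_)⟩
    rw [formEquiv_prodCoeff, hw, ← hu, hua, map_smul]
    change _ = _ • (formEquiv ℂ n c.1).1
    rw [MvPolynomial.smul_eq_C_mul, map_mul]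
    ring
  have hb0 : b ≠ 0 := by
    rintro rfl
    exact prodCoeff_ne_zero (v := fun i => (w i).1) (fun i => ne_zero_of_mem_unit_sphere _)
      (by rw [hb, zero_smul])
  have hbn : (‖b‖ : ℂ) ≠ 0 := Complex.ofReal_ne_zero.2 (norm_ne_zero_iff.2 hb0)
  refine ⟨(⟨‖b‖ * b⁻¹, by
    rw [mem_sphere_zero_iff_norm, norm_mul, norm_inv, Complex.norm_real, norm_norm,
      mul_inv_cancel₀ (norm_ne_zero_iff.2 hb0)]⟩, w), Subtype.ext ?_⟩
  simp only [sphereParam]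
  rw [hb, norm_smul, hc1, mul_one, smul_smul]
  have : ‖b‖ * b⁻¹ * (‖b‖ : ℂ)⁻¹ * b = 1 := by field_simp
  rw [this, one_smul]

/-- Since the parametrization by roots is a quotient map, root averages depend continuously on the
form. -/
theorem continuousOn_rootAverage {f : (Fin 2 → ℂ) → E}
    (hf : ∀ c : ℂ, c ≠ 0 → ∀ v, f (c • v) = f v) (hfc : ContinuousOn f {v | v ≠ 0}) :
    ContinuousOn (rootAverage f : (Fin (n + 1) → ℂ) → E) {c | c ≠ 0} := by
  have hsphere : Continuous fun c : Metric.sphere (0 : Fin (n + 1) → ℂ) 1 =>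
      rootAverage f c.1 := by
    rw [isQuotientMap_sphereParam.continuous_iff]
    have h : ((fun c : Metric.sphere (0 : Fin (n + 1) → ℂ) 1 => rootAverage f c.1) ∘ sphereParam) =
        fun p => ((Finset.univ : Finset (Fin n)).card : ℝ)⁻¹ • ∑ i, f (p.2 i).1 := by
      funext p
      have h0 : ∀ i, (p.2 i).1 ≠ 0 := fun i => ne_zero_of_mem_unit_sphere _
      have h1 : (p.1.1 * (‖prodCoeff fun i => (p.2 i).1‖ : ℂ)⁻¹) ≠ 0 :=
        mul_ne_zero (ne_zero_of_mem_unit_sphere p.1)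
          (inv_ne_zero (Complex.ofReal_ne_zero.2 (norm_ne_zero_iff.2 (prodCoeff_ne_zero h0))))
      exact ((hasRoots_prodCoeff h0).smul h1).rootAverage_eq hf
    rw [h]
    refine continuous_const.smul (continuous_finsetSum _ fun i _ => ?_)
    exact hfc.comp_continuous (by fun_prop) fun p => ne_zero_of_mem_unit_sphere _
  rw [continuousOn_iff_continuous_domRestrict]
  have h : Set.domRestrict {c : Fin (n + 1) → ℂ | c ≠ 0} (rootAverage f) =
      (fun c : Metric.sphere (0 : Fin (n + 1) → ℂ) 1 => rootAverage f c.1) ∘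
        fun c : {c : Fin (n + 1) → ℂ | c ≠ 0} => ⟨(‖c.1‖ : ℂ)⁻¹ • c.1, by
          have := norm_ne_zero_iff.2 c.2
          rw [mem_sphere_zero_iff_norm, norm_smul, norm_inv, Complex.norm_real, norm_norm,
            inv_mul_cancel₀ this]⟩ := by
    funext c
    have h1 : (‖c.1‖ : ℂ)⁻¹ ≠ 0 :=
      inv_ne_zero (Complex.ofReal_ne_zero.2 (norm_ne_zero_iff.2 c.2))
    exact (rootAverage_smul hf h1 c.2).symm
  rw [h]
  refine hsphere.comp (Continuous.subtype_mk (Continuous.smul (Continuous.inv₀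
    (Complex.continuous_ofReal.comp continuous_subtype_val.norm) fun c => ?_)
    continuous_subtype_val) _)
  exact Complex.ofReal_ne_zero.2 (norm_ne_zero_iff.2 c.2)

end RootAverage

/-! ### From `ℓ¹` vectors to probability measures -/

section ProbabilityMeasures

variable {S : Type*}

/-- The probability measure with the masses of a probability vector. -/
noncomputable def IsProbVector.toPMF {f : EllOne S} (hf : IsProbVector f) : PMF S :=
  ⟨fun s => ENNReal.ofReal (f s), by
    rw [ENNReal.summable.hasSum_iff, ← ENNReal.ofReal_tsum_of_nonneg hf.nonneg (ellOne_summable f),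
      hf.tsum_eq_one, ENNReal.ofReal_one]⟩

theorem IsProbVector.toReal_toPMF {f : EllOne S} (hf : IsProbVector f) (s : S) :
    (hf.toPMF s).toReal = f s :=
  ENNReal.toReal_ofReal (hf.nonneg s)

theorem translatePMF_apply {G : Type*} [Group G] (g : G) (m : PMF G) (s : G) :
    translatePMF g m s = m (g⁻¹ * s) := by
  classical
  rw [translatePMF, PMF.map_apply, tsum_eq_single (g⁻¹ * s)]
  · simp
  · intro h hh
    rw [if_neg]
    rintro rfl
    simp at hh

/-- Norm-continuous families of probability vectors are weak-* continuous. -/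
theorem continuous_toPMF {X : Type*} [TopologicalSpace X] {F : X → EllOne S} (hF : Continuous F)
    (hP : ∀ x, IsProbVector (F x)) :
    @Continuous X (PMF S) _ (weakStarTopology S) fun x => (hP x).toPMF := by
  refine continuous_induced_rng.2 (continuous_pi fun f => ?_)
  simp only [Function.comp_def, IsProbVector.toReal_toPMF]
  obtain ⟨C, hC⟩ : ∃ C, ∀ s, |f.1 s| ≤ C := by
    have h : ∀ᶠ s in cofinite, |f.1 s| < 1 := by
      have := f.2.abs
      rw [abs_zero] at this
      exact this.eventually_lt_const one_pos
    rw [eventually_cofinite] at h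
    obtain ⟨C, hC⟩ := (h.image fun s => |f.1 s|).bddAbove
    refine ⟨max C 1, fun s => ?_⟩
    by_cases hs : |f.1 s| < 1
    · exact hs.le.trans (le_max_right _ _)
    · exact (hC ⟨s, hs, rfl⟩).trans (le_max_left _ _)
  have hsum : ∀ g : EllOne S, Summable fun s => C * |g s| := fun g =>
    (ellOne_summable g).abs.mul_left C
  have hle : ∀ (g : EllOne S) (s : S), ‖f.1 s * g s‖ ≤ C * |g s| := fun g s => by
    rw [norm_mul]
    exact mul_le_mul_of_nonneg_right (hC s) (abs_nonneg _)
  have hsum' : ∀ g : EllOne S, Summable fun s => f.1 s * g s := fun g =>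
    Summable.of_norm_bounded (hsum g) (hle g)
  let Φ : EllOne S →ₗ[ℝ] ℝ :=
    { toFun := fun g => ∑' s, f.1 s * g s
      map_add' := fun g h => by
        rw [← (hsum' g).tsum_add (hsum' h)]
        exact tsum_congr fun s => by rw [lp.coeFn_add, Pi.add_apply, mul_add]
      map_smul' := fun c g => by
        rw [RingHom.id_apply, smul_eq_mul, ← tsum_mul_left]
        exact tsum_congr fun s => by rw [lp.coeFn_smul, Pi.smul_apply, smul_eq_mul]; ring }
  have hΦ : Continuous Φ := by
    refine (Φ.mkContinuous C fun g => ?_).continuous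
    rw [ellOne_norm_eq_tsum, ← tsum_mul_left]
    exact tsum_of_norm_bounded (hsum g).hasSum (hle g)
  exact hΦ.comp hF

end ProbabilityMeasures

/-! ### Discrete groups acting on projective spaces of binary forms -/

section Action

variable {K : Type*} [RCLike K] {n : ℕ}

theorem map_formEquiv (c : Fin (n + 1) → K) :
    MvPolynomial.map (complexEmbedding K) (formEquiv K n c).1 =
      (formEquiv ℂ n fun k => complexEmbedding K (c k)).1 := by
  change MvPolynomial.map _ (∑ k, MvPolynomial.monomial (formExponent n k) (c k)) = _
  simp only [map_sum, MvPolynomial.map_monomial]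
  rfl

theorem map_substitution (g : Matrix (Fin 2) (Fin 2) K) (P : MvPolynomial (Fin 2) K) :
    MvPolynomial.map (complexEmbedding K) (substitution g P) =
      substitution (g.map (complexEmbedding K)) (MvPolynomial.map (complexEmbedding K) P) := by
  induction P using MvPolynomial.induction_on with
  | C a => simp [substitution, MvPolynomial.algebraMap_eq]
  | add p q hp hq => simp only [map_add, hp, hq]
  | mul_X p i hp =>
    rw [map_mul, map_mul, hp, map_mul, map_mul]
    congr 1
    simp [substitution]

theorem complexEmbedding_coordRep (g : SL(2, K)) (c : Fin (n + 1) → K) :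
    (fun k => complexEmbedding K (coordRep K n g c k)) =
      coordRep ℂ n (Matrix.SpecialLinearGroup.map (complexEmbedding K) g)
        fun k => complexEmbedding K (c k) := by
  apply (formEquiv ℂ n).injective
  ext1
  rw [← map_formEquiv, formEquiv_coordRep, formEquiv_coordRep, map_substitution, map_formEquiv]
  rfl

theorem complexEmbedding_comp_ne_zero {c : Fin (n + 1) → K} (hc : c ≠ 0) :
    (fun k => complexEmbedding K (c k)) ≠ 0 := by
  intro h
  apply hc
  ext k
  exact (complexEmbedding K).injective ((congrFun h k).trans (map_zero _).symm)

variable (Γ : Subgroup SL(2, K))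

/-- The inclusion of a subgroup of `SL₂(K)` into `SL₂(ℂ)`. -/
noncomputable def complexInclusion : Γ →* SL(2, ℂ) :=
  (Matrix.SpecialLinearGroup.map (complexEmbedding K)).comp Γ.subtype

/-- The probability vector attached to a point of projective space: the average, over the roots of
the corresponding form, of the averages along the rays towards these roots. -/
noncomputable def formLaw (N i : ℕ) (x : ProjSpace K n) : EllOne Γ :=
  rootAverage (rayAverage (complexInclusion Γ) N i)
    fun k => complexEmbedding K (Projectivization.rep (K := K) (V := Fin (n + 1) → K) x k)

theorem formLaw_proj (N i : ℕ) (v : {v : Fin (n + 1) → K // v ≠ 0}) :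
    formLaw Γ N i (ProjSpace.proj K n v) =
      rootAverage (rayAverage (complexInclusion Γ) N i) fun k => complexEmbedding K (v.1 k) := by
  obtain ⟨a, ha⟩ := Projectivization.exists_smul_eq_mk_rep K v.1 v.2
  have h : (fun k => complexEmbedding K
      (Projectivization.rep (K := K) (V := Fin (n + 1) → K) (ProjSpace.proj K n v) k)) =
      complexEmbedding K a • fun k => complexEmbedding K (v.1 k) := by
    ext k
    change complexEmbedding K ((Projectivization.mk K v.1 v.2).rep k) = _
    rw [← ha]
    simp [Units.smul_def]
  rw [formLaw, h]
  exact rootAverage_smul (fun c hc v => rayAverage_smul hc i v)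
    ((map_ne_zero _).2 a.ne_zero) (complexEmbedding_comp_ne_zero v.2)

variable {Γ} {N : ℕ}
variable (hN : Summable fun γ : Γ => (‖entries (complexInclusion Γ γ).1‖ ^ N)⁻¹)
include hN

theorem continuous_formLaw (i : ℕ) : Continuous (formLaw (n := n) Γ N i) := by
  rw [(ProjSpace.isOpenQuotientMap_proj K n).isQuotientMap.continuous_iff]
  have h : formLaw (n := n) Γ N i ∘ ProjSpace.proj K n = fun v =>
      rootAverage (rayAverage (complexInclusion Γ) N i) fun k => complexEmbedding K (v.1 k) :=
    funext fun v => formLaw_proj Γ N i v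
  rw [h]
  have hcont : Continuous fun v : {v : Fin (n + 1) → K // v ≠ 0} =>
      fun k => complexEmbedding K (v.1 k) :=
    continuous_pi fun k => (continuous_complexEmbedding K).comp
      ((continuous_apply k).comp continuous_subtype_val)
  exact (continuousOn_rootAverage (fun c hc v => rayAverage_smul hc i v)
    (continuousOn_rayAverage hN i)).comp_continuous hcont
    fun v => complexEmbedding_comp_ne_zero v.2

theorem isProbVector_formLaw (hn : 1 ≤ n) (i : ℕ) (x : ProjSpace K n) :
    IsProbVector (formLaw Γ N i x) := by
  obtain ⟨v, rfl⟩ := ProjSpace.proj_surjective K n x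
  obtain ⟨w, hw⟩ := exists_hasRoots (complexEmbedding_comp_ne_zero v.2)
  rw [formLaw_proj, hw.rootAverage_eq fun c hc v => rayAverage_smul hc i v]
  have : Nonempty (Fin n) := ⟨⟨0, hn⟩⟩
  exact isProbVector_average Finset.univ_nonempty
    fun j _ => isProbVector_rayAverage hN (hw.ne_zero j) i

/-- Asymptotic equivariance of `formLaw`, uniformly over projective space. -/
theorem tendsto_tsum_formLaw_translate_sub (hn : 1 ≤ n) (s : Γ) :
    ∃ bound : ℕ → ℝ, Tendsto bound atTop (𝓝 0) ∧ ∀ (i : ℕ) (x : ProjSpace K n),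
      ∑' γ, |formLaw Γ N i x (s⁻¹ * γ) - formLaw Γ N i (s • x) γ| ≤ bound i := by
  obtain ⟨bound, hlim, hbound⟩ := tendsto_norm_translatedRayAverage_sub hN s
  refine ⟨bound, hlim, fun i x => ?_⟩
  obtain ⟨v, rfl⟩ := ProjSpace.proj_surjective K n x
  obtain ⟨w, hw⟩ := exists_hasRoots (complexEmbedding_comp_ne_zero v.2)
  have hinv : ∀ c : ℂ, c ≠ 0 → ∀ v, rayAverage (complexInclusion Γ) N i (c • v) =
      rayAverage (complexInclusion Γ) N i v := fun c hc v => rayAverage_smul hc i v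
  have hsx : s • ProjSpace.proj K n v = ProjSpace.proj K n ⟨coordRep K n s.1 v.1,
      (map_ne_zero_iff _ (coordRep_injective K n s.1)).2 v.2⟩ := rfl
  have hsw := hw.coordRep (complexInclusion Γ s)
  have h1 : formLaw Γ N i (s • ProjSpace.proj K n v) =
      ((Finset.univ : Finset (Fin n)).card : ℝ)⁻¹ •
        ∑ j, rayAverage (complexInclusion Γ) N i ((complexInclusion Γ s).1 *ᵥ w j) := by
    rw [hsx, formLaw_proj, ← hsw.rootAverage_eq hinv]
    congr 1
    exact complexEmbedding_coordRep s.1 v.1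
  have h2 : ∀ γ, formLaw Γ N i (ProjSpace.proj K n v) (s⁻¹ * γ) =
      (((Finset.univ : Finset (Fin n)).card : ℝ)⁻¹ •
        ∑ j, translatedRayAverage (complexInclusion Γ) N i s (w j) : EllOne Γ) γ := by
    intro γ
    rw [formLaw_proj, hw.rootAverage_eq hinv]
    rw [ellOne_average_apply, ellOne_average_apply]
    refine congrArg (_ * ·) (Finset.sum_congr rfl fun j _ => ?_)
    exact (translatedRayAverage_apply hN (hw.ne_zero j) i s γ).symm
  have h3 : ∀ f g : EllOne Γ, ∑' γ, |f γ - g γ| = ‖f - g‖ := fun f g => by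
    rw [ellOne_norm_eq_tsum]; rfl
  simp only [h1, h2]
  rw [h3, ← smul_sub, ← Finset.sum_sub_distrib, norm_smul, norm_inv, Real.norm_natCast]
  have hcard : (0 : ℝ) < (Finset.univ : Finset (Fin n)).card := by
    rw [Finset.card_fin]; exact_mod_cast hn
  rw [inv_mul_le_iff₀ hcard]
  refine (norm_sum_le_of_le _ fun j _ => hbound i (w j) (hw.ne_zero j)).trans ?_
  simp

end Action

theorem mainTheorem7 {K : Type*} [RCLike K] (n : ℕ) (hn : 1 ≤ n) (Γ : Subgroup SL(2, K))
    [DiscreteTopology Γ] :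
    IsTopologicallyAmenable Γ (ProjSpace K n) := by
  obtain ⟨N, hN'⟩ := exists_summable_inv_norm_pow Γ
  have hN : Summable fun γ : Γ => (‖entries (complexInclusion Γ γ).1‖ ^ N)⁻¹ :=
    hN'.congr fun γ => by rw [← norm_entries_map]; rfl
  refine ⟨ULift ℕ, inferInstance, ⟨fun a b => ⟨⟨max a.down b.down⟩, ?_, ?_⟩⟩, inferInstance,
    fun i x => (isProbVector_formLaw hN hn i.down x).toPMF, fun i => ?_, fun C hC => ?_⟩
  · exact le_max_left a.down b.down
  · exact le_max_right a.down b.down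
  · exact continuous_toPMF (continuous_formLaw hN i.down) _
  -- A compact subset of `Γ × ℙⁿ` involves only finitely many elements of `Γ`.
  · have hfin : (Prod.fst '' C).Finite := (hC.image continuous_fst).finite_of_discrete
    rw [Metric.tendstoUniformlyOn_iff]
    intro ε hε
    have hev : ∀ s ∈ Prod.fst '' C, ∀ᶠ i : ULift ℕ in atTop, ∀ x : ProjSpace K n,
        ∑' γ, |formLaw Γ N i.down x (s⁻¹ * γ) - formLaw Γ N i.down (s • x) γ| < ε := by
      intro s _
      obtain ⟨bound, hlim, hbound⟩ := tendsto_tsum_formLaw_translate_sub (n := n) hN hn s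
      obtain ⟨i₀, hi₀⟩ := eventually_atTop.1 (hlim.eventually_lt_const hε)
      exact eventually_atTop.2 ⟨⟨i₀⟩, fun i hi x => (hbound i.down x).trans_lt (hi₀ _ hi)⟩
    filter_upwards [(eventually_all_finite hfin).2 hev] with i hi p hp
    have h := hi p.1 ⟨p, hp, rfl⟩ p.2
    rw [dist_comm, Real.dist_eq, sub_zero, l1Dist,
      abs_of_nonneg (tsum_nonneg fun _ => abs_nonneg _)]
    simpa only [translatePMF_apply, IsProbVector.toReal_toPMF] using h
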